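/- **Model.** A network has nodes $1,\dots,N$ and a finite set $L$ of directed links $[n,m]$; $d_{\max}$ is the maximum in-degree. Time is slotted, $t=0,1,2,\dots$. In slot $t$ there is a channel state $S(t)$ in a finite set and an energy state in a finite set, which determines the harvestable energies $h_n(t)\in[0,h_{\max}]$. Each channel state $s$ has a compact set $\mathcal P^{(s)}$ of feasible power vectors $P=(P_{[n,m]})_{[n,m]\in L}$ with $P_{[n,m]}\ge 0$ and $\sum_bP_{[n,b]}\le P_{\max}$ for every $n$; it is closed under setting a component to zero. The link rates $\mu_{[n,m]}(s,P)\in[0,\mu_{\max}]$ satisfy, when $P'$ arises from $P\in\mathcal P^{(s)}$ by setting $P_{[n,m]}$ to zero, $\mu_{[n,m]}(s,P)\le\mu_{[n,m]}(s,P')+\delta P_{[n,m]}$ (with $\delta>0$ fixed) and $\mu_{[a,b]}(s,P)\le\mu_{[a,b]}(s,P')$ for all other links. The utility functions $U_n^{(c)}$ on $[0,\infty)$ are increasing, $C^1$ with bounded derivative, strictly concave, and $U_n^{(c)}(0)=0$; $\beta=\max_{n,c}(U_n^{(c)})'(0)$ and $U_{tot}(r)=\sum_{n,c}U_n^{(c)}(r^{nc})$.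 In every slot a policy chooses admissions $R_n^{(c)}(t)\in[0,R_{\max}]$ of data for destination $c$ at node $n$, a power vector $P(t)\in\mathcal P^{(S(t))}$ with $\sum_bP_{[n,b]}(t)\le E_n(t)$ for all $n$ (energy availability), rates $\mu^{(c)}_{[n,b]}(t)\ge0$ with $\sum_c\mu^{(c)}_{[n,b]}(t)\le\mu_{[n,b]}(S(t),P(t))$, and harvested amounts $e_n(t)\in[0,h_n(t)]$. The queues start at $0$ and evolve by $E_n(t+1)=E_n(t)-\sum_bP_{[n,b]}(t)+e_n(t)$ and, for $n\ne c$, $Q_n^{(c)}(t+1)=[Q_n^{(c)}(t)-\sum_b\mu^{(c)}_{[n,b]}(t)]^++\sum_a\tilde\mu^{(c)}_{[a,n]}(t)+R_n^{(c)}(t)$, while $Q_c^{(c)}=0$. Here $0\le\tilde\mu^{(c)}_{[n,b]}(t)\le\mu^{(c)}_{[n,b]}(t)$ is the amount really sent, with $\sum_b\tilde\mu_{[n,b]}^{(c)}(t)=\min\{Q_n^{(c)}(t),\sum_b\mu_{[n,b]}^{(c)}(t)\}$. When the states are random, policies are causal and may be randomized. Put $\bar r^{nc}_T=\frac1T\sum_{\tau<T}\mathbb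 E[R_n^{(c)}(\tau)]$ and $\bar r^{nc}=\liminf_{T\to\infty}\bar r_T^{nc}$. A policy is stable if $\limsup_T\frac1T\sum_{\tau<T}\sum_{n,c}\mathbb E[Q_n^{(c)}(\tau)]<\infty$. **Algorithm (ESA).** Let $V>0$, $\gamma=R_{\max}+d_{\max}\mu_{\max}$ and $\theta_n=\delta\beta V+P_{\max}$ for all $n$. In slot $t$: set $e_n(t)=h_n(t)$ if $E_n(t)<\theta_n$ and $e_n(t)=0$ otherwise; let $R_n^{(c)}(t)$ maximize $VU_n^{(c)}(r)-Q_n^{(c)}(t)r$ over $0\le r\le R_{\max}$; with $W^{(c)}_{[n,b]}=[Q_n^{(c)}(t)-Q_b^{(c)}(t)-\gamma]^+$ and $W_{[n,b]}=\max_cW_{[n,b]}^{(c)}$, let $P(t)$ maximize $G(P)=\sum_n\big[\sum_b\mu_{[n,b]}(S(t),P)W_{[n,b]}+(E_n(t)-\theta_n)\sum_bP_{[n,b]}\big]$ over the $P\in\mathcal P^{(S(t))}$ that satisfy energy availability; give the full rate of link $[n,b]$ to one commodity that attains $W_{[n,b]}$ if $W_{[n,b]}>0$, and nothing otherwise. Ties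 are broken arbitrarily. **Theorem.** (a) Along every sample path, for arbitrary state sequences, ESA satisfies for all $t$ $$0\le Q_n^{(c)}(t)\le\beta V+R_{\max},\qquad 0\le E_n(t)\le\theta_n+h_{\max}\qquad\text{for all }n,c,$$ and $E_n(t)\ge P_{\max}$ whenever node $n$ allocates nonzero power to an outgoing link. The energy-availability constraint is never violated, and it is redundant: the maximizers of $G$ over $\mathcal P^{(S(t))}$ with and without this constraint are the same. (b) Suppose that the pairs of channel and energy state are i.i.d. over the slots (the two components may be dependent). Let $$\tilde B=N^2\big(\tfrac32d_{\max}^2\mu_{\max}^2+R_{\max}^2\big)+\tfrac N2(P_{\max}+h_{\max})^2+N\gamma d_{\max}\mu_{\max},$$ which does not depend on $V$. Let $r^*$ be the vector of time average admitted rates of any stable policy, in particular of one for which $U_{tot}$ is largest. Then the averages $\bar r_T$ under ESA satisfy $$\liminf_{T\to\infty}U_{tot}(\bar r_T)\ge U_{tot}(r^*)-\tilde B/V .$$ Consequently, if the time averages under ESA exist, that is, if $\bar r_T^{nc}$ converges to $\bar r^{nc}$ for all $n,c$, then $U_{tot}(\bar r)\ge U_{tot}(r^*)-\tilde B/V$.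 -/

import Mathlib

open MeasureTheory ProbabilityTheory Filter Topology
open scoped ENNReal

universe u v w w'

/-- An energy harvesting network on the nodes `Fin N` with the directed links `L`; `S` is the set of
channel states and `H` the set of energy states. A power vector is a function on the links. -/
structure EHNetwork {N : ℕ} (L : Finset (Fin N × Fin N)) (S : Type u) (H : Type v) where
  /-- `U n c` is the utility of the commodity `c` data admitted at node `n`. -/
  U : Fin N → Fin N → ℝ → ℝ
  /-- the feasible power allocation set of a channel state -/
  powerSet : S → Set (↥L → ℝ)
  /-- the rate-power function -/
  rate : S → (↥L → ℝ) → ↥L → ℝ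
  /-- the harvestable energy vector of an energy state -/
  harvest : H → Fin N → ℝ
  Rmax : ℝ
  Pmax : ℝ
  μmax : ℝ
  hmax : ℝ
  δ : ℝ
  Rmax_nonneg : 0 ≤ Rmax
  Pmax_nonneg : 0 ≤ Pmax
  μmax_nonneg : 0 ≤ μmax
  hmax_nonneg : 0 ≤ hmax
  δ_pos : 0 < δ
  U_zero : ∀ n c, U n c 0 = 0
  U_increasing : ∀ n c, StrictMonoOn (U n c) (Set.Ici 0)
  U_contDiff : ∀ n c, ContDiffOn ℝ 1 (U n c) (Set.Ici 0)
  U_strictConcave : ∀ n c, StrictConcaveOn ℝ (Set.Ici 0) (U n c)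
  U_deriv_bounded : ∀ n c, ∃ C, ∀ r, 0 ≤ r → |derivWithin (U n c) (Set.Ici 0) r| ≤ C
  powerSet_compact : ∀ i, IsCompact (powerSet i)
  power_nonneg : ∀ i, ∀ p ∈ powerSet i, ∀ l, 0 ≤ p l
  power_le : ∀ i, ∀ p ∈ powerSet i, ∀ n, (∑ l : ↥L with l.1.1 = n, p l) ≤ Pmax
  powerSet_update_zero : ∀ i, ∀ p ∈ powerSet i, ∀ l, Function.update p l 0 ∈ powerSet i
  rate_nonneg : ∀ i, ∀ p ∈ powerSet i, ∀ l, 0 ≤ rate i p l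
  rate_le : ∀ i, ∀ p ∈ powerSet i, ∀ l, rate i p l ≤ μmax
  /-- the rate of a link is at most linear in its own power -/
  rate_own : ∀ i, ∀ p ∈ powerSet i, ∀ l,
    rate i p l ≤ rate i (Function.update p l 0) l + δ * p l
  /-- removing the power of a link does not reduce the rate of any other link -/
  rate_other : ∀ i, ∀ p ∈ powerSet i, ∀ l l', l' ≠ l →
    rate i p l' ≤ rate i (Function.update p l 0) l'
  harvest_nonneg : ∀ j n, 0 ≤ harvest j n
  harvest_le : ∀ j n, harvest j n ≤ hmax

/-- All decisions and queues along one sample path. -/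
structure SamplePath {N : ℕ} (L : Finset (Fin N × Fin N)) where
  /-- `R t n c`: commodity `c` data admitted at node `n` -/
  R : ℕ → Fin N → Fin N → ℝ
  /-- `P t l`: power allocated to link `l` -/
  P : ℕ → ↥L → ℝ
  /-- `alloc t l c`: rate of link `l` allocated to commodity `c` -/
  alloc : ℕ → ↥L → Fin N → ℝ
  /-- `flow t l c`: commodity `c` data really sent over link `l`; less than the allocated rate if
  the sender has too little data (the rest of the rate is filled with idle data) -/
  flow : ℕ → ↥L → Fin N → ℝ
  /-- `e t n`: energy harvested at node `n` -/
  e : ℕ → Fin N → ℝ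
  /-- `Q t n c`: backlog of commodity `c` data at node `n` -/
  Q : ℕ → Fin N → Fin N → ℝ
  /-- `E t n`: energy stored at node `n` -/
  E : ℕ → Fin N → ℝ

/-- Total of a link quantity over the outgoing links of `n`. -/
def outSum {N : ℕ} {L : Finset (Fin N × Fin N)} (x : ↥L → ℝ) (n : Fin N) : ℝ :=
  ∑ l : ↥L with l.1.1 = n, x l

/-- Total of a link quantity over the incoming links of `n`. -/
def inSum {N : ℕ} {L : Finset (Fin N × Fin N)} (x : ↥L → ℝ) (n : Fin N) : ℝ :=
  ∑ l : ↥L with l.1.2 = n, x l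

/-- The maximum in-degree. -/
def maxInDegree {N : ℕ} (L : Finset (Fin N × Fin N)) : ℕ :=
  Finset.univ.sup fun n : Fin N => (L.filter fun l => l.2 = n).card

namespace EHNetwork

variable {N : ℕ} {L : Finset (Fin N × Fin N)} {S : Type u} {H : Type v}

/-- The largest (one-sided) derivative at `0` of the utility functions. -/
noncomputable def β (M : EHNetwork L S H) : ℝ :=
  ⨆ p : Fin N × Fin N, derivWithin (M.U p.1 p.2) (Set.Ici 0) 0

/-- `γ = R_max + d_max μ_max`. -/
noncomputable def γ (M : EHNetwork L S H) : ℝ :=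
  M.Rmax + maxInDegree L * M.μmax

/-- The perturbation `θ = δ β V + P_max`, the same for all nodes. -/
noncomputable def θ (M : EHNetwork L S H) (V : ℝ) : ℝ :=
  M.δ * M.β * V + M.Pmax

/-- `B = N² (3/2 d_max² μ_max² + R_max²) + N/2 (P_max + h_max)²`. -/
noncomputable def B (M : EHNetwork L S H) : ℝ :=
  (N : ℝ) ^ 2 * (3 / 2 * (maxInDegree L : ℝ) ^ 2 * M.μmax ^ 2 + M.Rmax ^ 2)
    + (N : ℝ) / 2 * (M.Pmax + M.hmax) ^ 2

/-- `B̃ = B + N γ d_max μ_max`; it does not involve `V`. -/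
noncomputable def Btilde (M : EHNetwork L S H) : ℝ :=
  M.B + N * M.γ * maxInDegree L * M.μmax

/-- Total utility of a rate vector. -/
noncomputable def Utot (M : EHNetwork L S H) (r : Fin N → Fin N → ℝ) : ℝ :=
  ∑ n, ∑ c, M.U n c (r n c)

/-- The power vectors that are feasible in channel state `i` and satisfy the energy-availability
constraint for the energy levels `E`. -/
def availablePower (M : EHNetwork L S H) (i : S) (E : Fin N → ℝ) : Set (↥L → ℝ) :=
  {p | p ∈ M.powerSet i ∧ ∀ n, outSum p n ≤ E n}

/-- The sample path `x` obeys all constraints and the queueing dynamics of the network, for the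
channel states `s` and the energy states `h`. -/
structure IsFeasible (M : EHNetwork L S H) (s : ℕ → S) (h : ℕ → H) (x : SamplePath L) :
    Prop where
  admission : ∀ t n c, 0 ≤ x.R t n c ∧ x.R t n c ≤ M.Rmax
  power : ∀ t, x.P t ∈ M.availablePower (s t) (x.E t)
  alloc_nonneg : ∀ t l c, 0 ≤ x.alloc t l c
  alloc_le : ∀ t l, ∑ c, x.alloc t l c ≤ M.rate (s t) (x.P t) l
  flow_nonneg : ∀ t l c, 0 ≤ x.flow t l c
  flow_le : ∀ t l c, x.flow t l c ≤ x.alloc t l c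
  /-- a node sends as much of its backlog as the allocated rates permit -/
  flow_sum : ∀ t n c,
    outSum (fun l => x.flow t l c) n = min (x.Q t n c) (outSum (fun l => x.alloc t l c) n)
  harvesting : ∀ t n, 0 ≤ x.e t n ∧ x.e t n ≤ M.harvest (h t) n
  Q_init : ∀ n c, x.Q 0 n c = 0
  /-- data leave the network at their destination -/
  Q_dest : ∀ t c, x.Q t c c = 0
  Q_step : ∀ t n c, n ≠ c → x.Q (t + 1) n c =
    max (x.Q t n c - outSum (fun l => x.alloc t l c) n) 0
      + inSum (fun l => x.flow t l c) n + x.R t n c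
  E_init : ∀ n, x.E 0 n = 0
  E_step : ∀ t n, x.E (t + 1) n = x.E t n - outSum (x.P t) n + x.e t n

/-- The weight of commodity `c` over link `l` when the backlogs are `Q`. -/
noncomputable def weight (M : EHNetwork L S H) (Q : Fin N → Fin N → ℝ) (l : ↥L) (c : Fin N) : ℝ :=
  max (Q l.1.1 c - Q l.1.2 c - M.γ) 0

/-- The weight of a link: the maximum over the commodities. -/
noncomputable def linkWeight (M : EHNetwork L S H) (Q : Fin N → Fin N → ℝ) (l : ↥L) : ℝ :=
  ⨆ c, M.weight Q l c

/-- The objective of the power allocation step. -/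
noncomputable def powerObjective (M : EHNetwork L S H) (θ : Fin N → ℝ) (i : S)
    (Q : Fin N → Fin N → ℝ) (E : Fin N → ℝ) (p : ↥L → ℝ) : ℝ :=
  ∑ n, (outSum (fun l => M.rate i p l * M.linkWeight Q l) n + (E n - θ n) * outSum p n)

/-- The sample path `x` is produced by the Energy-limited Scheduling Algorithm with parameter `V`
and perturbation `θ`. Ties between maximizers are broken in any way. -/
structure IsESA (M : EHNetwork L S H) (V : ℝ) (θ : Fin N → ℝ) (s : ℕ → S) (h : ℕ → H)
    (x : SamplePath L) : Prop where
  feasible : M.IsFeasible s h x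
  harvesting : ∀ t n, (x.E t n - θ n < 0 → x.e t n = M.harvest (h t) n) ∧
    (0 ≤ x.E t n - θ n → x.e t n = 0)
  admission : ∀ t n c,
    IsMaxOn (fun r => V * M.U n c r - x.Q t n c * r) (Set.Icc 0 M.Rmax) (x.R t n c)
  power : ∀ t, IsMaxOn (M.powerObjective θ (s t) (x.Q t) (x.E t))
    (M.availablePower (s t) (x.E t)) (x.P t)
  routing : ∀ t l, ∃ c', (∀ c, M.weight (x.Q t) l c ≤ M.weight (x.Q t) l c') ∧
    (0 < M.weight (x.Q t) l c' → x.alloc t l c' = M.rate (s t) (x.P t) l) ∧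
    (M.weight (x.Q t) l c' ≤ 0 → x.alloc t l c' = 0) ∧
    ∀ c, c ≠ c' → x.alloc t l c = 0

/-- A (possibly randomized) causal policy, with i.i.d. states of law `π`. `ℱ t` is the information
from before the states of slot `t` are revealed: the state pair of slot `t` has law `π` and is
independent of `ℱ t`; together with the decisions of slot `t` it belongs to `ℱ (t + 1)`. -/
structure IsPolicy (M : EHNetwork L S H) (π : PMF (S × H)) {Ω : Type w} [mΩ : MeasurableSpace Ω]
    (Pr : Measure Ω) (ℱ : Filtration ℕ mΩ) (s : ℕ → Ω → S) (h : ℕ → Ω → H)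
    (X : Ω → SamplePath L) : Prop where
  state_meas : ∀ t, Measurable[ℱ (t + 1), ⊤] fun ω => (s t ω, h t ω)
  state_law : ∀ t i j, Pr {ω | s t ω = i ∧ h t ω = j} = π (i, j)
  state_indep : ∀ t,
    Indep (MeasurableSpace.comap (fun ω => (s t ω, h t ω)) (⊤ : MeasurableSpace (S × H))) (ℱ t) Pr
  R_meas : ∀ t n c, Measurable[ℱ (t + 1)] fun ω => (X ω).R t n c
  P_meas : ∀ t l, Measurable[ℱ (t + 1)] fun ω => (X ω).P t l
  alloc_meas : ∀ t l c, Measurable[ℱ (t + 1)] fun ω => (X ω).alloc t l c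
  flow_meas : ∀ t l c, Measurable[ℱ (t + 1)] fun ω => (X ω).flow t l c
  e_meas : ∀ t n, Measurable[ℱ (t + 1)] fun ω => (X ω).e t n
  feasible : ∀ ω, M.IsFeasible (fun t => s t ω) (fun t => h t ω) (X ω)

end EHNetwork

section Averages

variable {N : ℕ} {L : Finset (Fin N × Fin N)} {Ω : Type w} [MeasurableSpace Ω]

/-- The expected admitted rate averaged over the slots `0, …, T - 1`. -/
noncomputable def avgRate (Pr : Measure Ω) (X : Ω → SamplePath L) (T : ℕ) (n c : Fin N) : ℝ :=
  1 / (T : ℝ) * ∑ τ ∈ Finset.range T, ∫ ω, (X ω).R τ n c ∂Pr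

/-- The time average admitted rate vector. -/
noncomputable def timeAvgRate (Pr : Measure Ω) (X : Ω → SamplePath L) (n c : Fin N) : ℝ :=
  liminf (fun T => avgRate Pr X T n c) atTop

/-- Network stability: the time average expected total backlog is finite. -/
def IsStable (Pr : Measure Ω) (X : Ω → SamplePath L) : Prop :=
  limsup (fun T : ℕ => (∑ τ ∈ Finset.range T, ∑ n, ∑ c, ∫⁻ ω, ENNReal.ofReal ((X ω).Q τ n c) ∂Pr)
    / (T : ℝ≥0∞)) atTop < ⊤

end Averages

/-- `r` is the time average admitted rate vector of a stabilizing policy, that is, a feasible point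
of the utility maximization problem (on any probability space). -/
def EHNetwork.IsAchievable {N : ℕ} {L : Finset (Fin N × Fin N)} {S : Type u} {H : Type v}
    (M : EHNetwork L S H) (π : PMF (S × H)) (r : Fin N → Fin N → ℝ) : Prop :=
  ∃ (Ω : Type w) (mΩ : MeasurableSpace Ω) (Pr : Measure Ω) (_ : IsProbabilityMeasure Pr)
    (ℱ : Filtration ℕ mΩ) (s : ℕ → Ω → S) (h : ℕ → Ω → H) (X : Ω → SamplePath L),
    M.IsPolicy π Pr ℱ s h X ∧ IsStable Pr X ∧ r = timeAvgRate Pr X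

/-!
Part (a) is an induction along a sample path. A node receives commodity `c` over a link only if
its backlog is at least `γ` below that of the sender, and `γ` is the most that can arrive in a slot;
it admits nothing once its backlog exceeds `β V`, the largest marginal utility
(`EHNetwork.IsESA.Q_le`). Hence every link weight is at most `β V`, so for a sender holding less
than `Pmax` the `δ W` per unit of power that a link can earn is less than the `θ - E` it costs, and
switching the link off raises the objective. Doing so link by link turns any feasible power vector
into an available one that is no worse (`EHNetwork.exists_available_ge`). This makes the
energy-availability constraint redundant, without any continuity of the rates and without knowing
that maximizers exist.

Part (b) is a drift-plus-penalty argument. The competing stable policy is replaced by its conditional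
averages given the state, taken up to a single slot `T` that is large and at which its expected
backlogs are moderate (`EHNetwork.IsPolicy.exists_isStationaryBound`). Stability provides such
slots, flow conservation up to `T` then holds up to `ε`, and no limit of policies is needed. These
averages need not be feasible decisions, but they satisfy all linear inequalities that feasible
decisions satisfy, and the bound of the objective by its maximum under ESA is such an inequality
once backlogs and batteries are fixed. Here redundancy is essential: ESA maximizes over all
feasible powers, whatever its batteries hold.

The resulting pathwise inequality `EHNetwork.IsESA.drift_plus_penalty_le` is integrated using the
independence of the state of a slot from the past (`EHNetwork.IsPolicy.integral_mul_state`), summed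
over time, and combined with Jensen's inequality; then `T → ∞` under ESA and `ε → 0`.
-/

/-! ### Link sums and node sums -/

section LinkSums

variable {N : ℕ} {L : Finset (Fin N × Fin N)}

lemma outSum_nonneg {x : ↥L → ℝ} (hx : ∀ l, 0 ≤ x l) (n : Fin N) : 0 ≤ outSum x n :=
  Finset.sum_nonneg fun l _ => hx l

lemma inSum_nonneg {x : ↥L → ℝ} (hx : ∀ l, 0 ≤ x l) (n : Fin N) : 0 ≤ inSum x n :=
  Finset.sum_nonneg fun l _ => hx l

lemma outSum_mono {x y : ↥L → ℝ} (h : ∀ l, x l ≤ y l) (n : Fin N) : outSum x n ≤ outSum y n :=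
  Finset.sum_le_sum fun l _ => h l

lemma inSum_mono {x y : ↥L → ℝ} (h : ∀ l, x l ≤ y l) (n : Fin N) : inSum x n ≤ inSum y n :=
  Finset.sum_le_sum fun l _ => h l

lemma sum_mul_outSum (w : Fin N → ℝ) (x : ↥L → ℝ) :
    ∑ n, w n * outSum x n = ∑ l : ↥L, w l.1.1 * x l := by
  rw [← Finset.sum_fiberwise (s := Finset.univ) (g := fun l : ↥L => l.1.1)]
  refine Finset.sum_congr rfl fun n _ => ?_
  rw [outSum, Finset.mul_sum]
  refine Finset.sum_congr rfl fun l hl => ?_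
  rw [(Finset.mem_filter.1 hl).2]

lemma sum_mul_inSum (w : Fin N → ℝ) (x : ↥L → ℝ) :
    ∑ n, w n * inSum x n = ∑ l : ↥L, w l.1.2 * x l := by
  rw [← Finset.sum_fiberwise (s := Finset.univ) (g := fun l : ↥L => l.1.2)]
  refine Finset.sum_congr rfl fun n _ => ?_
  rw [inSum, Finset.mul_sum]
  refine Finset.sum_congr rfl fun l hl => ?_
  rw [(Finset.mem_filter.1 hl).2]

/-- Summation by parts: the backlog differences over the links, weighted by the flows, equal the
net outflows weighted by the backlogs. -/
lemma sum_mul_backlog_sub (y : ↥L → Fin N → ℝ) (Q : Fin N → Fin N → ℝ) :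
    ∑ l : ↥L, ∑ c, y l c * (Q l.1.1 c - Q l.1.2 c) =
      ∑ n, ∑ c, Q n c * outSum (fun l => y l c) n
        - ∑ n, ∑ c, Q n c * inSum (fun l => y l c) n := by
  rw [Finset.sum_comm, Finset.sum_comm (f := fun n c => Q n c * outSum (fun l => y l c) n),
    Finset.sum_comm (f := fun n c => Q n c * inSum (fun l => y l c) n), ← Finset.sum_sub_distrib]
  refine Finset.sum_congr rfl fun c _ => ?_
  rw [sum_mul_outSum (fun n => Q n c), sum_mul_inSum (fun n => Q n c), ← Finset.sum_sub_distrib]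
  exact Finset.sum_congr rfl fun l _ => by ring

lemma card_incoming_le (n : Fin N) :
    (Finset.univ.filter fun l : ↥L => l.1.2 = n).card ≤ maxInDegree L := by
  refine le_trans ?_ (Finset.le_sup (f := fun n : Fin N => (L.filter fun l => l.2 = n).card)
    (Finset.mem_univ n))
  refine Finset.card_le_card_of_injOn Subtype.val ?_ Subtype.val_injective.injOn
  intro l hl
  simpa using hl

lemma card_outgoing_le (n : Fin N) :
    (Finset.univ.filter fun l : ↥L => l.1.1 = n).card ≤ N := by
  have : (Finset.univ : Finset (Fin N)).card = N := by simp
  refine le_of_le_of_eq ?_ this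
  refine Finset.card_le_card_of_injOn (fun l => l.1.2) (fun _ _ => by simp) ?_
  intro l hl l' hl' h
  simp only [Finset.coe_filter, Finset.mem_univ, true_and, Set.mem_ofPred_eq] at hl hl'
  exact Subtype.ext (Prod.ext (hl.trans hl'.symm) h)

lemma card_links_le : Fintype.card ↥L ≤ N * maxInDegree L := by
  have h := Finset.card_eq_sum_card_fiberwise (f := fun l : ↥L => l.1.2) (s := Finset.univ)
    (t := Finset.univ) (fun _ _ => by simp)
  rw [← Finset.card_univ, h]
  refine (Finset.sum_le_sum fun n _ => card_incoming_le n).trans ?_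
  simp

lemma inSum_le_of_le {x : ↥L → ℝ} {K : ℝ} (hK : 0 ≤ K) (hx : ∀ l, x l ≤ K) (n : Fin N) :
    inSum x n ≤ maxInDegree L * K := by
  refine (Finset.sum_le_card_nsmul _ _ K fun l _ => hx l).trans ?_
  rw [nsmul_eq_mul]
  exact mul_le_mul_of_nonneg_right (by exact_mod_cast card_incoming_le n) hK

end LinkSums

namespace EHNetwork

variable {N : ℕ} {L : Finset (Fin N × Fin N)} {S : Type u} {H : Type v}

/-! ### Utility functions -/

lemma U_mono (M : EHNetwork L S H) (n c : Fin N) {a b : ℝ} (ha : 0 ≤ a) (hab : a ≤ b) :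
    M.U n c a ≤ M.U n c b :=
  (M.U_increasing n c).monotoneOn ha (ha.trans hab) hab

lemma U_nonneg (M : EHNetwork L S H) (n c : Fin N) {a : ℝ} (ha : 0 ≤ a) : 0 ≤ M.U n c a := by
  simpa [M.U_zero] using M.U_mono n c le_rfl ha

lemma U_le_β_mul (M : EHNetwork L S H) (n c : Fin N) {r : ℝ} (hr : 0 ≤ r) :
    M.U n c r ≤ M.β * r := by
  rcases hr.eq_or_lt with rfl | hr
  · simp [M.U_zero]
  have hd : DifferentiableWithinAt ℝ (M.U n c) (Set.Ici 0) 0 :=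
    (M.U_contDiff n c).differentiableOn one_ne_zero 0 (by simp)
  have h1 := (M.U_strictConcave n c).concaveOn.slope_le_derivWithin (x := 0) (y := r)
    (by simp) hr.le hr hd
  have h2 : derivWithin (M.U n c) (Set.Ici 0) 0 ≤ M.β :=
    le_ciSup (f := fun p : Fin N × Fin N => derivWithin (M.U p.1 p.2) (Set.Ici 0) 0)
      (Set.finite_range _).bddAbove (n, c)
  have h3 := h1.trans h2
  rw [slope_def_field, M.U_zero, sub_zero, sub_zero, div_le_iff₀ hr] at h3
  exact h3

lemma β_nonneg (M : EHNetwork L S H) : 0 ≤ M.β := by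
  rcases isEmpty_or_nonempty (Fin N) with hN | ⟨⟨n⟩⟩
  · simp [β, Real.iSup_of_isEmpty]
  · have := M.U_le_β_mul n n zero_le_one
    have h1 := M.U_nonneg n n zero_le_one
    linarith

/-- Concavity makes the increments of a utility function decreasing, so the slope `β` at `0`
bounds all of them. -/
lemma U_add_le (M : EHNetwork L S H) (n c : Fin N) {a b : ℝ} (ha : 0 ≤ a) (hb : 0 ≤ b) :
    M.U n c (a + b) ≤ M.U n c a + M.β * b := by
  have hU := (M.U_strictConcave n c).concaveOn
  have h2 := M.U_le_β_mul n c hb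
  rcases (add_nonneg ha hb).eq_or_lt with h | h
  · obtain rfl : a = 0 := by linarith
    obtain rfl : b = 0 := by linarith
    simp
  -- both `a` and `b` are convex combinations of `0` and `a + b`
  have key : ∀ x, 0 ≤ x → x ≤ a + b → x / (a + b) * M.U n c (a + b) ≤ M.U n c x := by
    intro x hx hxs
    have := hU.2 (show (0 : ℝ) ∈ Set.Ici 0 by simp) (show a + b ∈ Set.Ici 0 from h.le)
      (show 0 ≤ 1 - x / (a + b) by rw [sub_nonneg]; exact div_le_one_of_le₀ hxs h.le)
      (show 0 ≤ x / (a + b) by positivity) (by ring)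
    simpa [M.U_zero, h.ne'] using this
  have h3 := key a ha (by linarith)
  have h4 := key b hb (by linarith)
  have h5 : a / (a + b) * M.U n c (a + b) + b / (a + b) * M.U n c (a + b) = M.U n c (a + b) := by
    field_simp
  linarith

lemma γ_nonneg (M : EHNetwork L S H) : 0 ≤ M.γ :=
  add_nonneg M.Rmax_nonneg (mul_nonneg (Nat.cast_nonneg _) M.μmax_nonneg)

lemma Rmax_le_γ (M : EHNetwork L S H) : M.Rmax ≤ M.γ :=
  le_add_of_nonneg_right (mul_nonneg (Nat.cast_nonneg _) M.μmax_nonneg)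

lemma Pmax_le_θ (M : EHNetwork L S H) {V : ℝ} (hV : 0 ≤ V) : M.Pmax ≤ M.θ V :=
  le_add_of_nonneg_left (mul_nonneg (mul_nonneg M.δ_pos.le M.β_nonneg) hV)

/-! ### Queues along a feasible sample path -/

section Feasible

variable {M : EHNetwork L S H} {s : ℕ → S} {h : ℕ → H} {x : SamplePath L}

lemma IsFeasible.alloc_le_μmax (hx : M.IsFeasible s h x) (t : ℕ) (l : ↥L) (c : Fin N) :
    x.alloc t l c ≤ M.μmax :=
  (Finset.single_le_sum (fun c _ => hx.alloc_nonneg t l c) (Finset.mem_univ c)).trans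
    ((hx.alloc_le t l).trans (M.rate_le _ _ (hx.power t).1 l))

lemma IsFeasible.Q_nonneg (hx : M.IsFeasible s h x) (t : ℕ) (n c : Fin N) : 0 ≤ x.Q t n c := by
  by_cases hnc : n = c
  · subst hnc; exact (hx.Q_dest t n).ge
  cases t with
  | zero => exact (hx.Q_init n c).ge
  | succ t =>
    rw [hx.Q_step t n c hnc]
    have := inSum_nonneg (fun l => hx.flow_nonneg t l c) n
    have := (hx.admission t n c).1
    positivity

lemma IsFeasible.E_nonneg (hx : M.IsFeasible s h x) (t : ℕ) (n : Fin N) : 0 ≤ x.E t n :=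
  (outSum_nonneg (fun l => M.power_nonneg _ _ (hx.power t).1 l) n).trans ((hx.power t).2 n)

lemma IsFeasible.Q_step_flow (hx : M.IsFeasible s h x) (t : ℕ) (n c : Fin N) (hnc : n ≠ c) :
    x.Q (t + 1) n c = x.Q t n c - outSum (fun l => x.flow t l c) n
      + inSum (fun l => x.flow t l c) n + x.R t n c := by
  rw [hx.Q_step t n c hnc, hx.flow_sum t n c]
  rcases le_total (x.Q t n c) (outSum (fun l => x.alloc t l c) n) with h | h
  · rw [min_eq_left h, max_eq_right (by linarith)]; ring
  · rw [min_eq_right h, max_eq_left (by linarith)]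

end Feasible

/-! ### The power allocation step -/

lemma powerObjective_eq (M : EHNetwork L S H) (θ : Fin N → ℝ) (i : S) (Q : Fin N → Fin N → ℝ)
    (E : Fin N → ℝ) (p : ↥L → ℝ) :
    M.powerObjective θ i Q E p =
      ∑ l : ↥L, (M.rate i p l * M.linkWeight Q l + (E l.1.1 - θ l.1.1) * p l) := by
  rw [powerObjective, Finset.sum_add_distrib, Finset.sum_add_distrib,
    sum_mul_outSum (fun n => E n - θ n)]
  congr 1
  simpa using sum_mul_outSum (fun _ => (1 : ℝ)) (fun l => M.rate i p l * M.linkWeight Q l)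

lemma weight_le_linkWeight (M : EHNetwork L S H) (Q : Fin N → Fin N → ℝ) (l : ↥L) (c : Fin N) :
    M.weight Q l c ≤ M.linkWeight Q l :=
  le_ciSup (Set.finite_range _).bddAbove c

lemma linkWeight_nonneg (M : EHNetwork L S H) (Q : Fin N → Fin N → ℝ) (l : ↥L) :
    0 ≤ M.linkWeight Q l :=
  (le_max_right _ _).trans (M.weight_le_linkWeight Q l l.1.1)

lemma linkWeight_eq (M : EHNetwork L S H) (Q : Fin N → Fin N → ℝ) (l : ↥L) (c' : Fin N)
    (hc' : ∀ c, M.weight Q l c ≤ M.weight Q l c') : M.linkWeight Q l = M.weight Q l c' :=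
  have : Nonempty (Fin N) := ⟨c'⟩
  le_antisymm (ciSup_le hc') (M.weight_le_linkWeight Q l c')

lemma linkWeight_le (M : EHNetwork L S H) {V : ℝ} (hV : 0 ≤ V) {Q : Fin N → Fin N → ℝ}
    (hQ : ∀ n c, 0 ≤ Q n c ∧ Q n c ≤ M.β * V + M.Rmax) (l : ↥L) :
    M.linkWeight Q l ≤ M.β * V := by
  have : Nonempty (Fin N) := ⟨l.1.1⟩
  refine ciSup_le fun c => max_le ?_ (mul_nonneg M.β_nonneg hV)
  have := (hQ l.1.1 c).2
  have := (hQ l.1.2 c).1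
  have := M.Rmax_le_γ
  linarith

/-- Switching off a link costs at most `δ` times its weight per unit of power and saves
`θ - E` per unit of power. -/
lemma powerObjective_update_zero (M : EHNetwork L S H) (θ : Fin N → ℝ) (i : S)
    (Q : Fin N → Fin N → ℝ) (E : Fin N → ℝ) {p : ↥L → ℝ} (hp : p ∈ M.powerSet i) (l : ↥L) :
    M.powerObjective θ i Q E p + p l * (θ l.1.1 - E l.1.1 - M.δ * M.linkWeight Q l) ≤
      M.powerObjective θ i Q E (Function.update p l 0) := by
  rw [powerObjective_eq, powerObjective_eq, ← Finset.add_sum_erase _ _ (Finset.mem_univ l),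
    ← Finset.add_sum_erase _ _ (Finset.mem_univ l)]
  have h1 : ∑ l' ∈ Finset.univ.erase l,
      (M.rate i p l' * M.linkWeight Q l' + (E l'.1.1 - θ l'.1.1) * p l') ≤
      ∑ l' ∈ Finset.univ.erase l, (M.rate i (Function.update p l 0) l' * M.linkWeight Q l'
        + (E l'.1.1 - θ l'.1.1) * Function.update p l 0 l') := by
    refine Finset.sum_le_sum fun l' hl' => ?_
    have hne := Finset.ne_of_mem_erase hl'
    rw [Function.update_of_ne hne]
    gcongr
    · exact M.linkWeight_nonneg Q l'
    · exact M.rate_other i p hp l l' hne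
  have h2 := mul_le_mul_of_nonneg_right (M.rate_own i p hp l) (M.linkWeight_nonneg Q l)
  simp only [Function.update_self, mul_zero, add_zero]
  linarith

/-- Under the bound on the link weights, a node whose battery holds less than `Pmax` gains by
switching off any active link. -/
lemma powerObjective_gain_pos (M : EHNetwork L S H) {V : ℝ} {Q : Fin N → Fin N → ℝ}
    {E : Fin N → ℝ} (hW : ∀ l : ↥L, M.linkWeight Q l ≤ M.β * V) (l : ↥L)
    (hE : E l.1.1 < M.Pmax) : 0 < M.θ V - E l.1.1 - M.δ * M.linkWeight Q l := by
  have := mul_le_mul_of_nonneg_left (hW l) M.δ_pos.le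
  simp only [θ]
  linarith

lemma Pmax_le_of_isMaxOn (M : EHNetwork L S H) {V : ℝ} {i : S} {Q : Fin N → Fin N → ℝ}
    {E : Fin N → ℝ} (hW : ∀ l : ↥L, M.linkWeight Q l ≤ M.β * V) {A : Set (↥L → ℝ)}
    (hA : A ⊆ M.powerSet i) {p : ↥L → ℝ} (hp : p ∈ A)
    (hAp : ∀ l, Function.update p l 0 ∈ A)
    (hmax : IsMaxOn (M.powerObjective (fun _ => M.θ V) i Q E) A p) (l : ↥L) (hl : p l ≠ 0) :
    M.Pmax ≤ E l.1.1 := by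
  by_contra! hE
  have h1 := M.powerObjective_update_zero (fun _ => M.θ V) i Q E (hA hp) l
  have h2 := M.powerObjective_gain_pos hW l hE
  have h3 : 0 < p l := lt_of_le_of_ne (M.power_nonneg i p (hA hp) l) hl.symm
  have h4 := isMaxOn_iff.1 hmax _ (hAp l)
  have := mul_pos h3 h2
  linarith

lemma mem_availablePower_of_Pmax_le (M : EHNetwork L S H) {i : S} {E : Fin N → ℝ}
    (hE : ∀ n, 0 ≤ E n) {p : ↥L → ℝ} (hp : p ∈ M.powerSet i)
    (h : ∀ l, p l ≠ 0 → M.Pmax ≤ E l.1.1) : p ∈ M.availablePower i E := by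
  refine ⟨hp, fun n => ?_⟩
  rcases le_or_gt M.Pmax (E n) with hn | hn
  · exact (M.power_le i p hp n).trans hn
  · rw [outSum, Finset.sum_eq_zero]
    · exact hE n
    · intro l hl
      by_contra h0
      have := h l h0
      rw [(Finset.mem_filter.1 hl).2] at this
      exact hn.not_ge this

lemma update_mem_availablePower (M : EHNetwork L S H) {i : S} {E : Fin N → ℝ} {p : ↥L → ℝ}
    (hp : p ∈ M.availablePower i E) (l : ↥L) :
    Function.update p l 0 ∈ M.availablePower i E := by
  refine ⟨M.powerSet_update_zero i p hp.1 l, fun n => (outSum_mono (fun l' => ?_) n).trans (hp.2 n)⟩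
  by_cases hl : l' = l
  · subst hl; simpa using M.power_nonneg i p hp.1 l'
  · rw [Function.update_of_ne hl]

/-- Every feasible power vector is dominated by an available one: switch off, one after the
other, all links whose sender holds less than `Pmax`. -/
lemma exists_available_ge (M : EHNetwork L S H) {V : ℝ} {i : S} {Q : Fin N → Fin N → ℝ}
    {E : Fin N → ℝ} (hE : ∀ n, 0 ≤ E n) (hW : ∀ l : ↥L, M.linkWeight Q l ≤ M.β * V)
    {p : ↥L → ℝ} (hp : p ∈ M.powerSet i) :
    ∃ p' ∈ M.availablePower i E, M.powerObjective (fun _ => M.θ V) i Q E p ≤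
      M.powerObjective (fun _ => M.θ V) i Q E p' := by
  have key : ∀ A : Finset ↥L, ∃ p' ∈ M.powerSet i, M.powerObjective (fun _ => M.θ V) i Q E p ≤
      M.powerObjective (fun _ => M.θ V) i Q E p' ∧
      ∀ l ∈ A, p' l ≠ 0 → M.Pmax ≤ E l.1.1 := by
    intro A
    induction A using Finset.induction_on with
    | empty => exact ⟨p, hp, le_rfl, by simp⟩
    | insert l A _ ih =>
      obtain ⟨p', hp', hle, hA⟩ := ih
      rcases le_or_gt M.Pmax (E l.1.1) with hl | hl
      · refine ⟨p', hp', hle, fun l' hl' => ?_⟩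
        rcases Finset.mem_insert.1 hl' with rfl | hl'
        · exact fun _ => hl
        · exact hA l' hl'
      · refine ⟨Function.update p' l 0, M.powerSet_update_zero i p' hp' l, ?_, fun l' hl' => ?_⟩
        · have h1 := M.powerObjective_update_zero (fun _ => M.θ V) i Q E hp' l
          have h2 := M.powerObjective_gain_pos hW l hl
          have := mul_nonneg (M.power_nonneg i p' hp' l) h2.le
          linarith
        · by_cases hll : l' = l
          · subst hll; simp
          · rw [Function.update_of_ne hll]
            exact hA l' ((Finset.mem_insert.1 hl').resolve_left hll)
  obtain ⟨p', hp', hle, h⟩ := key Finset.univ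
  exact ⟨p', M.mem_availablePower_of_Pmax_le hE hp' fun l => h l (Finset.mem_univ l), hle⟩

/-- The energy-availability constraint is redundant for the maximization of the objective. -/
lemma isMaxOn_powerSet_iff (M : EHNetwork L S H) {V : ℝ} {i : S} {Q : Fin N → Fin N → ℝ}
    {E : Fin N → ℝ} (hE : ∀ n, 0 ≤ E n) (hW : ∀ l : ↥L, M.linkWeight Q l ≤ M.β * V)
    (p : ↥L → ℝ) :
    (p ∈ M.powerSet i ∧ IsMaxOn (M.powerObjective (fun _ => M.θ V) i Q E) (M.powerSet i) p) ↔
    (p ∈ M.availablePower i E ∧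
      IsMaxOn (M.powerObjective (fun _ => M.θ V) i Q E) (M.availablePower i E) p) := by
  constructor
  · rintro ⟨hp, hmax⟩
    exact ⟨M.mem_availablePower_of_Pmax_le hE hp
      (M.Pmax_le_of_isMaxOn hW subset_rfl hp (M.powerSet_update_zero i p hp) hmax),
      hmax.on_subset fun _ h => h.1⟩
  · rintro ⟨hp, hmax⟩
    refine ⟨hp.1, isMaxOn_iff.2 fun q hq => ?_⟩
    obtain ⟨q', hq', hle⟩ := M.exists_available_ge hE hW hq
    exact hle.trans (isMaxOn_iff.1 hmax q' hq')

/-! ### Deterministic queue bounds -/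

section ESA

variable {M : EHNetwork L S H} {V : ℝ} {s : ℕ → S} {h : ℕ → H} {x : SamplePath L}

/-- No data are admitted where the backlog exceeds `β V`, the largest marginal utility. -/
lemma IsESA.R_eq_zero {θ : Fin N → ℝ} (hx : M.IsESA V θ s h x) (hV : 0 ≤ V) {t : ℕ} {n c : Fin N}
    (hQ : M.β * V < x.Q t n c) : x.R t n c = 0 := by
  by_contra hne
  have hR := hx.feasible.admission t n c
  have hpos : 0 < x.R t n c := lt_of_le_of_ne hR.1 (Ne.symm hne)
  have h1 := isMaxOn_iff.1 (hx.admission t n c) 0 ⟨le_rfl, M.Rmax_nonneg⟩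
  simp only [M.U_zero, mul_zero, sub_zero] at h1
  have h2 := mul_le_mul_of_nonneg_left (M.U_le_β_mul n c hR.1) hV
  have h3 := mul_lt_mul_of_pos_right hQ hpos
  linarith

/-- A link that carries commodity `c` bridges a differential backlog larger than `γ`. -/
lemma IsESA.Q_lt_of_alloc_ne_zero {θ : Fin N → ℝ} (hx : M.IsESA V θ s h x) {t : ℕ} {l : ↥L}
    {c : Fin N} (hl : x.alloc t l c ≠ 0) : x.Q t l.1.2 c + M.γ < x.Q t l.1.1 c := by
  obtain ⟨c', -, -, h0, hother⟩ := hx.routing t l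
  have hc : c = c' := by
    by_contra hne
    exact hl (hother c hne)
  subst hc
  have hw : 0 < M.weight (x.Q t) l c := by
    by_contra! hle
    exact hl (h0 hle)
  rcases lt_max_iff.1 hw with h | h
  · linarith
  · exact absurd h (lt_irrefl _)

lemma IsESA.Q_le {θ : Fin N → ℝ} (hx : M.IsESA V θ s h x) (hV : 0 ≤ V) (t : ℕ) :
    ∀ n c, x.Q t n c ≤ M.β * V + M.Rmax := by
  have hβV : 0 ≤ M.β * V := mul_nonneg M.β_nonneg hV
  have hR0 := M.Rmax_nonneg
  induction t with
  | zero => intro n c; rw [hx.feasible.Q_init]; positivity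
  | succ t ih =>
    intro n c
    by_cases hnc : n = c
    · subst hnc; rw [hx.feasible.Q_dest]; positivity
    have hR := hx.feasible.admission t n c
    have hstep := hx.feasible.Q_step t n c hnc
    have hout : max (x.Q t n c - outSum (fun l => x.alloc t l c) n) 0 ≤ x.Q t n c :=
      max_le (sub_le_self _ (outSum_nonneg (fun l => hx.feasible.alloc_nonneg t l c) n))
        (hx.feasible.Q_nonneg t n c)
    by_cases hin : ∃ l : ↥L, l.1.2 = n ∧ x.alloc t l c ≠ 0
    · obtain ⟨l, rfl, hl⟩ := hin
      have h1 := hx.Q_lt_of_alloc_ne_zero hl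
      have h2 := ih l.1.1 c
      have h3 : inSum (fun l => x.flow t l c) l.1.2 ≤ maxInDegree L * M.μmax :=
        inSum_le_of_le M.μmax_nonneg
          (fun l' => (hx.feasible.flow_le t l' c).trans (hx.feasible.alloc_le_μmax t l' c)) _
      simp only [γ] at h1
      linarith
    · push Not at hin
      have h3 : inSum (fun l => x.flow t l c) n = 0 := by
        refine Finset.sum_eq_zero fun l hl => le_antisymm ?_ (hx.feasible.flow_nonneg t l c)
        rw [← hin l (Finset.mem_filter.1 hl).2]
        exact hx.feasible.flow_le t l c
      rcases le_or_gt (x.Q t n c) (M.β * V) with hQ | hQ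
      · linarith
      · have := hx.R_eq_zero hV hQ
        have := ih n c
        linarith

lemma IsESA.E_le (hx : M.IsESA V (fun _ => M.θ V) s h x) (hV : 0 ≤ V) (t : ℕ) (n : Fin N) :
    x.E t n ≤ M.θ V + M.hmax := by
  have hθ : 0 ≤ M.θ V := M.Pmax_nonneg.trans (M.Pmax_le_θ hV)
  have hh := M.hmax_nonneg
  induction t with
  | zero => rw [hx.feasible.E_init]; positivity
  | succ t ih =>
    rw [hx.feasible.E_step]
    have h1 := outSum_nonneg (fun l => M.power_nonneg _ _ (hx.feasible.power t).1 l) n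
    rcases lt_or_ge (x.E t n - M.θ V) 0 with hE | hE
    · have := (hx.feasible.harvesting t n).2.trans (M.harvest_le (h t) n)
      linarith
    · rw [(hx.harvesting t n).2 hE]
      linarith

lemma IsESA.linkWeight_le (hx : M.IsESA V (fun _ => M.θ V) s h x) (hV : 0 ≤ V) (t : ℕ) (l : ↥L) :
    M.linkWeight (x.Q t) l ≤ M.β * V :=
  M.linkWeight_le hV (fun n c => ⟨hx.feasible.Q_nonneg t n c, hx.Q_le hV t n c⟩) l

/-- In every slot ESA maximizes the objective over all feasible power vectors, available or not. -/
lemma IsESA.isMaxOn_powerSet (hx : M.IsESA V (fun _ => M.θ V) s h x) (hV : 0 ≤ V) (t : ℕ) :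
    IsMaxOn (M.powerObjective (fun _ => M.θ V) (s t) (x.Q t) (x.E t)) (M.powerSet (s t)) (x.P t) :=
  ((M.isMaxOn_powerSet_iff (hx.feasible.E_nonneg t) (hx.linkWeight_le hV t) _).2
    ⟨hx.feasible.power t, hx.power t⟩).2

end ESA

end EHNetwork

/-! ### Conditional time averages given the state -/

section CondAvg

variable {Ω : Type w} [MeasurableSpace Ω] {A : Type u}

open Classical in
/-- The average over the slots `τ < T` of the conditional expectation of `g τ` given that the
state `st τ` of the slot is `z`; the number `q` stands for the probability of `z`. -/
noncomputable def condAvg (Pr : Measure Ω) (st : ℕ → Ω → A) (q : A → ℝ) (T : ℕ) (g : ℕ → Ω → ℝ)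
    (z : A) : ℝ :=
  (T * q z)⁻¹ * ∑ τ ∈ Finset.range T, ∫ ω, (if st τ ω = z then g τ ω else 0) ∂Pr

variable {Pr : Measure Ω} {st : ℕ → Ω → A} {q : A → ℝ} {T : ℕ}

open Classical in
lemma integrable_ite_state (hst : ∀ τ z, MeasurableSet {ω | st τ ω = z}) {g : Ω → ℝ}
    (hg : Integrable g Pr) (τ : ℕ) (z : A) :
    Integrable (fun ω => if st τ ω = z then g ω else 0) Pr := by
  have := hg.indicator (hst τ z)
  refine this.congr (Eventually.of_forall fun ω => ?_)
  simp [Set.indicator_apply]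

lemma condAvg_add (hst : ∀ τ z, MeasurableSet {ω | st τ ω = z}) {f g : ℕ → Ω → ℝ}
    (hf : ∀ τ, Integrable (f τ) Pr) (hg : ∀ τ, Integrable (g τ) Pr) (z : A) :
    condAvg Pr st q T (fun τ ω => f τ ω + g τ ω) z
      = condAvg Pr st q T f z + condAvg Pr st q T g z := by
  classical
  simp only [condAvg]
  rw [← mul_add, ← Finset.sum_add_distrib]
  congr 1
  refine Finset.sum_congr rfl fun τ _ => ?_
  rw [← integral_add (integrable_ite_state hst (hf τ) τ z) (integrable_ite_state hst (hg τ) τ z)]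
  refine integral_congr_ae (Eventually.of_forall fun ω => ?_)
  dsimp only
  split_ifs <;> simp

lemma condAvg_const_mul (a : ℝ) (g : ℕ → Ω → ℝ) (z : A) :
    condAvg Pr st q T (fun τ ω => a * g τ ω) z = a * condAvg Pr st q T g z := by
  classical
  simp only [condAvg]
  rw [mul_left_comm, Finset.mul_sum (a := a)]
  congr 1
  refine Finset.sum_congr rfl fun τ _ => ?_
  rw [← integral_const_mul]
  simp only [mul_ite, mul_zero]

lemma condAvg_sum (hst : ∀ τ z, MeasurableSet {ω | st τ ω = z}) {ι : Type*} (B : Finset ι)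
    {g : ι → ℕ → Ω → ℝ} (hg : ∀ i τ, Integrable (g i τ) Pr) (z : A) :
    condAvg Pr st q T (fun τ ω => ∑ i ∈ B, g i τ ω) z = ∑ i ∈ B, condAvg Pr st q T (g i) z := by
  classical
  induction B using Finset.induction_on with
  | empty => simp [condAvg]
  | insert i B hi ih =>
    simp only [Finset.sum_insert hi]
    rw [condAvg_add hst (hg i) (fun τ => integrable_finsetSum _ fun i _ => hg i τ), ih]

lemma condAvg_le [IsProbabilityMeasure Pr] (hst : ∀ τ z, MeasurableSet {ω | st τ ω = z})
    (hq : ∀ τ z, Pr.real {ω | st τ ω = z} = q z) (hT : T ≠ 0) {g : ℕ → Ω → ℝ}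
    (hg : ∀ τ, Integrable (g τ) Pr) {z : A} (hz : 0 < q z) {K : ℝ}
    (hK : ∀ τ ω, st τ ω = z → g τ ω ≤ K) : condAvg Pr st q T g z ≤ K := by
  classical
  have hT' : (0 : ℝ) < T := by exact_mod_cast Nat.pos_of_ne_zero hT
  rw [condAvg, inv_mul_le_iff₀ (by positivity)]
  calc ∑ τ ∈ Finset.range T, ∫ ω, (if st τ ω = z then g τ ω else 0) ∂Pr
      ≤ ∑ τ ∈ Finset.range T, q z * K := by
        refine Finset.sum_le_sum fun τ _ => ?_
        have h1 : ∫ ω, (if st τ ω = z then K else 0) ∂Pr = q z * K := by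
          have h2 := integral_indicator_const (μ := Pr) K (hst τ z)
          rw [hq, smul_eq_mul] at h2
          rw [← h2]
          refine integral_congr_ae (Eventually.of_forall fun ω => ?_)
          simp [Set.indicator_apply]
        rw [← h1]
        refine integral_mono (integrable_ite_state hst (hg τ) τ z)
          (integrable_ite_state hst (integrable_const K) τ z) fun ω => ?_
        dsimp only
        split_ifs with hω
        · exact hK τ ω hω
        · exact le_rfl
    _ = T * q z * K := by simp [mul_assoc]

lemma sum_mul_condAvg [Fintype A] [IsFiniteMeasure Pr]
    (hst : ∀ τ z, MeasurableSet {ω | st τ ω = z})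
    (hq : ∀ τ z, Pr.real {ω | st τ ω = z} = q z) {g : ℕ → Ω → ℝ}
    (hg : ∀ τ, Integrable (g τ) Pr) :
    ∑ z, q z * condAvg Pr st q T g z = 1 / (T : ℝ) * ∑ τ ∈ Finset.range T, ∫ ω, g τ ω ∂Pr := by
  classical
  have h1 : ∀ z, q z * condAvg Pr st q T g z =
      (T : ℝ)⁻¹ * ∑ τ ∈ Finset.range T, ∫ ω, (if st τ ω = z then g τ ω else 0) ∂Pr := by
    intro z
    by_cases hz : q z = 0
    · -- a state of probability zero contributes nothing on either side
      have h2 : ∀ τ ∈ Finset.range T, ∫ ω, (if st τ ω = z then g τ ω else 0) ∂Pr = 0 := by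
        intro τ _
        refine integral_eq_zero_of_ae ?_
        have h3 : Pr {ω | st τ ω = z} = 0 := by
          rw [← measureReal_eq_zero_iff, hq, hz]
        filter_upwards [measure_eq_zero_iff_ae_notMem.1 h3] with ω hω
        exact if_neg hω
      rw [hz, Finset.sum_eq_zero h2]; simp
    · rw [condAvg, mul_inv]
      field_simp
  rw [Finset.sum_congr rfl fun z _ => h1 z, ← Finset.mul_sum, one_div, Finset.sum_comm]
  congr 1
  refine Finset.sum_congr rfl fun τ _ => ?_
  rw [← integral_finsetSum _ fun z _ => integrable_ite_state hst (hg τ) τ z]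
  refine integral_congr_ae (Eventually.of_forall fun ω => ?_)
  simp

end CondAvg

/-! ### Measurability, independence and integrability along a policy -/

namespace EHNetwork

variable {N : ℕ} {L : Finset (Fin N × Fin N)} {S : Type u} {H : Type v}
  {M : EHNetwork L S H} {π : PMF (S × H)} {Ω : Type w} [mΩ : MeasurableSpace Ω]
  {Pr : Measure Ω} {ℱ : Filtration ℕ mΩ} {s : ℕ → Ω → S} {h : ℕ → Ω → H} {X : Ω → SamplePath L}

lemma IsPolicy.measurableSet_state (hX : M.IsPolicy π Pr ℱ s h X) (t : ℕ) (z : S × H) :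
    MeasurableSet {ω | (s t ω, h t ω) = z} :=
  ℱ.le (t + 1) _ (hX.state_meas t (MeasurableSpace.measurableSet_top (s := {z})))

lemma IsPolicy.real_state (hX : M.IsPolicy π Pr ℱ s h X) (t : ℕ) (z : S × H) :
    Pr.real {ω | (s t ω, h t ω) = z} = (π z).toReal := by
  rw [Measure.real, ← hX.state_law t z.1 z.2]
  simp [Prod.ext_iff]

lemma IsPolicy.Q_meas (hX : M.IsPolicy π Pr ℱ s h X) (t : ℕ) (n c : Fin N) :
    Measurable[ℱ t] fun ω => (X ω).Q t n c := by
  induction t generalizing n c with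
  | zero =>
    simp only [(hX.feasible _).Q_init]
    exact measurable_const
  | succ t ih =>
    by_cases hnc : n = c
    · subst hnc
      simp only [(hX.feasible _).Q_dest]
      exact measurable_const
    simp only [(hX.feasible _).Q_step_flow t n c hnc, outSum, inSum]
    have h1 := (ih n c).mono (ℱ.mono t.le_succ) le_rfl
    exact ((h1.sub (Finset.measurable_fun_sum _ fun l _ => hX.flow_meas t l c)).add
      (Finset.measurable_fun_sum _ fun l _ => hX.flow_meas t l c)).add (hX.R_meas t n c)

lemma IsPolicy.E_meas (hX : M.IsPolicy π Pr ℱ s h X) (t : ℕ) (n : Fin N) :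
    Measurable[ℱ t] fun ω => (X ω).E t n := by
  induction t with
  | zero =>
    simp only [(hX.feasible _).E_init]
    exact measurable_const
  | succ t ih =>
    simp only [(hX.feasible _).E_step t n, outSum]
    have h1 := ih.mono (ℱ.mono t.le_succ) le_rfl
    exact (h1.sub (Finset.measurable_fun_sum _ fun l _ => hX.P_meas t l)).add (hX.e_meas t n)

/-- What is known before slot `t` is independent of the state of slot `t`. -/
lemma IsPolicy.integral_mul_state [Fintype S] [Fintype H] [IsProbabilityMeasure Pr]
    (hX : M.IsPolicy π Pr ℱ s h X) {t : ℕ} {Z : Ω → ℝ} (hZ : Measurable[ℱ t] Z)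
    (φ : S × H → ℝ) :
    ∫ ω, Z ω * φ (s t ω, h t ω) ∂Pr = (∫ ω, Z ω ∂Pr) * ∑ z, (π z).toReal * φ z := by
  let _ : MeasurableSpace (S × H) := ⊤
  have hst : Measurable fun ω => (s t ω, h t ω) := (hX.state_meas t).mono (ℱ.le _) le_rfl
  have hφ : Measurable φ := measurable_from_top
  have hind : IndepFun Z (fun ω => φ (s t ω, h t ω)) Pr := by
    rw [IndepFun_iff_Indep]
    refine indep_of_indep_of_le (hX.state_indep t).symm hZ.comap_le ?_
    rintro _ ⟨B, hB, rfl⟩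
    exact ⟨φ ⁻¹' B, trivial, rfl⟩
  have h1 := hind.integral_mul_eq_mul_integral
    (hZ.mono (ℱ.le t) le_rfl).aestronglyMeasurable (hφ.comp hst).aestronglyMeasurable
  refine h1.trans ?_
  congr 1
  have h2 : ∫ ω, φ (s t ω, h t ω) ∂Pr = ∫ z, φ z ∂(Pr.map fun ω => (s t ω, h t ω)) :=
    (integral_map hst.aemeasurable hφ.aestronglyMeasurable).symm
  have : IsProbabilityMeasure (Pr.map fun ω => (s t ω, h t ω)) :=
    Measure.isProbabilityMeasure_map hst.aemeasurable
  rw [h2, integral_fintype .of_finite]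
  refine Finset.sum_congr rfl fun z _ => ?_
  rw [map_measureReal_apply hst trivial, smul_eq_mul, ← hX.real_state t z]
  rfl

lemma IsPolicy.R_integrable [IsFiniteMeasure Pr] (hX : M.IsPolicy π Pr ℱ s h X) (t : ℕ)
    (n c : Fin N) : Integrable (fun ω => (X ω).R t n c) Pr := by
  refine .of_bound ((hX.R_meas t n c).mono (ℱ.le _) le_rfl).aestronglyMeasurable M.Rmax
    (Eventually.of_forall fun ω => ?_)
  have := (hX.feasible ω).admission t n c
  rw [Real.norm_of_nonneg this.1]
  exact this.2

lemma IsPolicy.flow_integrable [IsFiniteMeasure Pr] (hX : M.IsPolicy π Pr ℱ s h X) (t : ℕ)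
    (l : ↥L) (c : Fin N) : Integrable (fun ω => (X ω).flow t l c) Pr := by
  refine .of_bound ((hX.flow_meas t l c).mono (ℱ.le _) le_rfl).aestronglyMeasurable M.μmax
    (Eventually.of_forall fun ω => ?_)
  rw [Real.norm_of_nonneg ((hX.feasible ω).flow_nonneg t l c)]
  exact ((hX.feasible ω).flow_le t l c).trans ((hX.feasible ω).alloc_le_μmax t l c)

lemma IsPolicy.P_integrable [IsFiniteMeasure Pr] (hX : M.IsPolicy π Pr ℱ s h X) (t : ℕ)
    (l : ↥L) : Integrable (fun ω => (X ω).P t l) Pr := by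
  refine .of_bound ((hX.P_meas t l).mono (ℱ.le _) le_rfl).aestronglyMeasurable M.Pmax
    (Eventually.of_forall fun ω => ?_)
  have hp := ((hX.feasible ω).power t).1
  rw [Real.norm_of_nonneg (M.power_nonneg _ _ hp l)]
  refine le_trans ?_ (M.power_le _ _ hp l.1.1)
  exact Finset.single_le_sum (f := (X ω).P t) (fun l _ => M.power_nonneg _ _ hp l) (by simp)

end EHNetwork

/-! ### Time averages of a stable policy as averages over the states -/

/-- A sequence whose running averages are bounded has a bounded subsequence. -/
lemma exists_frequently_le_of_limsup_avg_lt_top {q : ℕ → ℝ≥0∞}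
    (hq : limsup (fun T : ℕ => (∑ τ ∈ Finset.range T, q τ) / (T : ℝ≥0∞)) atTop < ⊤) :
    ∃ C : ℝ≥0∞, C < ⊤ ∧ ∀ T₀, ∃ T ≥ T₀, q T ≤ C := by
  obtain ⟨c, hc, hctop⟩ := exists_between hq
  refine ⟨2 * c, ENNReal.mul_lt_top (by simp) hctop, fun T₀ => ?_⟩
  obtain ⟨T₁, hT₁⟩ := eventually_atTop.1 (eventually_lt_of_limsup_lt hc)
  set T := max (max T₀ T₁) 1 with hTdef
  have hT0 : T₀ ≤ T := (le_max_left _ _).trans (le_max_left _ _)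
  have hT1 : T₁ ≤ T := (le_max_right _ _).trans (le_max_left _ _)
  have hTpos : 1 ≤ T := le_max_right _ _
  by_contra! hbig
  have h1 := hT₁ (2 * T) (by omega)
  rw [ENNReal.div_lt_iff (.inl (Nat.cast_ne_zero.2 (by omega)))
    (.inl (ENNReal.natCast_ne_top _))] at h1
  -- already the slots `T ≤ τ < 2 T` exceed the bound on the sum up to `2 T`
  have h2 : ∑ τ ∈ Finset.Ico T (2 * T), 2 * c ≤ ∑ τ ∈ Finset.range (2 * T), q τ := by
    refine (Finset.sum_le_sum fun τ hτ => ?_).trans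
      (Finset.sum_le_sum_of_subset (s := Finset.Ico T (2 * T)) fun τ hτ => ?_)
    · exact (hbig τ (hT0.trans (Finset.mem_Ico.1 hτ).1)).le
    · exact Finset.mem_range.2 (Finset.mem_Ico.1 hτ).2
  rw [Finset.sum_const, Nat.card_Ico, nsmul_eq_mul, show 2 * T - T = T by omega] at h2
  refine absurd (h2.trans_lt h1) (not_lt.2 (le_of_eq ?_))
  push_cast
  ring

namespace EHNetwork

variable {N : ℕ} {L : Finset (Fin N × Fin N)} {S : Type u} {H : Type v}

/-- Decisions that depend on the state `z` of a slot only, in expectation: admissions `ρ`, flows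
`f z` and powers `p z`. They serve the rates `r` up to `ε`, keep flow conservation up to `ε` and
the energy balance on average over the law `π` of the states. Feasibility in a state `z` is
expressed by duality: every linear inequality that holds for all the feasible flows and powers of
the state holds for `(f z, p z)`. -/
structure IsStationaryBound (M : EHNetwork L S H) [Fintype S] [Fintype H] (π : PMF (S × H))
    (r : Fin N → Fin N → ℝ) (ε : ℝ) (ρ : Fin N → Fin N → ℝ) (f : S × H → ↥L → Fin N → ℝ)
    (p : S × H → ↥L → ℝ) : Prop where
  rate_nonneg : ∀ n c, 0 ≤ r n c
  rate_le : ∀ n c, r n c ≤ ρ n c + ε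
  admission : ∀ n c, 0 ≤ ρ n c ∧ ρ n c ≤ M.Rmax
  feasible : ∀ z, π z ≠ 0 → ∀ (a : ↥L → Fin N → ℝ) (b : ↥L → ℝ) (K : ℝ),
    (∀ q ∈ M.powerSet z.1, ∀ y : ↥L → Fin N → ℝ, (∀ l c, 0 ≤ y l c) →
      (∀ l, ∑ c, y l c ≤ M.rate z.1 q l) → ∑ l, ∑ c, a l c * y l c + ∑ l, b l * q l ≤ K) →
    ∑ l, ∑ c, a l c * f z l c + ∑ l, b l * p z l ≤ K
  balance : ∀ n c, n ≠ c → ρ n c + ∑ z, (π z).toReal *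
    (inSum (fun l => f z l c) n - outSum (fun l => f z l c) n) ≤ ε
  energy : ∀ n, ∑ z, (π z).toReal * outSum (p z) n ≤ ∑ z, (π z).toReal * M.harvest z.2 n

section Policy

variable {M : EHNetwork L S H} {π : PMF (S × H)} {Ω : Type w} [mΩ : MeasurableSpace Ω]
  {Pr : Measure Ω} {ℱ : Filtration ℕ mΩ} {s : ℕ → Ω → S} {h : ℕ → Ω → H} {X : Ω → SamplePath L}

lemma IsFeasible.Q_eq_sum {s : ℕ → S} {h : ℕ → H} {x : SamplePath L} (hx : M.IsFeasible s h x)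
    {n c : Fin N} (hnc : n ≠ c) (T : ℕ) :
    x.Q T n c = ∑ τ ∈ Finset.range T, (inSum (fun l => x.flow τ l c) n
      - outSum (fun l => x.flow τ l c) n + x.R τ n c) := by
  induction T with
  | zero => simp [hx.Q_init]
  | succ T ih => rw [Finset.sum_range_succ, ← ih, hx.Q_step_flow T n c hnc]; ring

lemma IsFeasible.E_eq_sum {s : ℕ → S} {h : ℕ → H} {x : SamplePath L} (hx : M.IsFeasible s h x)
    (n : Fin N) (T : ℕ) :
    x.E T n = ∑ τ ∈ Finset.range T, (x.e τ n - outSum (x.P τ) n) := by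
  induction T with
  | zero => simp [hx.E_init]
  | succ T ih => rw [Finset.sum_range_succ, ← ih, hx.E_step T n]; ring

lemma IsPolicy.inSum_flow_integrable [IsFiniteMeasure Pr] (hX : M.IsPolicy π Pr ℱ s h X) (t : ℕ)
    (n c : Fin N) : Integrable (fun ω => inSum (fun l => (X ω).flow t l c) n) Pr :=
  integrable_finsetSum _ fun l _ => hX.flow_integrable t l c

lemma IsPolicy.outSum_flow_integrable [IsFiniteMeasure Pr] (hX : M.IsPolicy π Pr ℱ s h X) (t : ℕ)
    (n c : Fin N) : Integrable (fun ω => outSum (fun l => (X ω).flow t l c) n) Pr :=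
  integrable_finsetSum _ fun l _ => hX.flow_integrable t l c

lemma IsPolicy.outSum_P_integrable [IsFiniteMeasure Pr] (hX : M.IsPolicy π Pr ℱ s h X) (t : ℕ)
    (n : Fin N) : Integrable (fun ω => outSum ((X ω).P t) n) Pr :=
  integrable_finsetSum _ fun l _ => hX.P_integrable t l

lemma IsPolicy.Q_integrable [IsFiniteMeasure Pr] (hX : M.IsPolicy π Pr ℱ s h X) (t : ℕ)
    (n c : Fin N) : Integrable (fun ω => (X ω).Q t n c) Pr := by
  by_cases hnc : n = c
  · subst hnc
    simp [(hX.feasible _).Q_dest]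
  · simp only [(hX.feasible _).Q_eq_sum hnc]
    exact integrable_finsetSum _ fun τ _ => ((hX.inSum_flow_integrable τ n c).sub
      (hX.outSum_flow_integrable τ n c)).add (hX.R_integrable τ n c)

/-- Under a stable policy the expected backlogs stay bounded along a sequence of slots. -/
lemma IsPolicy.exists_integral_Q_le [IsFiniteMeasure Pr] (hX : M.IsPolicy π Pr ℱ s h X)
    (hst : IsStable Pr X) :
    ∃ C : ℝ, ∀ T₀, ∃ T ≥ T₀, ∀ n c, ∫ ω, (X ω).Q T n c ∂Pr ≤ C := by
  obtain ⟨C, hC, hfreq⟩ := exists_frequently_le_of_limsup_avg_lt_top hst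
  refine ⟨C.toReal, fun T₀ => ?_⟩
  obtain ⟨T, hT, hle⟩ := hfreq T₀
  refine ⟨T, hT, fun n c => ?_⟩
  have h1 : ∫⁻ ω, ENNReal.ofReal ((X ω).Q T n c) ∂Pr ≤ C := by
    refine le_trans ?_ hle
    refine le_trans ?_ (Finset.single_le_sum (f := fun n => ∑ c, ∫⁻ ω, ENNReal.ofReal
      ((X ω).Q T n c) ∂Pr) (fun _ _ => zero_le) (Finset.mem_univ n))
    exact Finset.single_le_sum (f := fun c => ∫⁻ ω, ENNReal.ofReal
      ((X ω).Q T n c) ∂Pr) (fun _ _ => zero_le) (Finset.mem_univ c)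
  rw [← ofReal_integral_eq_lintegral_ofReal (hX.Q_integrable T n c)
    (Eventually.of_forall fun ω => (hX.feasible ω).Q_nonneg T n c)] at h1
  exact (ENNReal.ofReal_le_iff_le_toReal hC.ne).1 h1

lemma IsPolicy.avgRate_mem_Icc [IsProbabilityMeasure Pr] (hX : M.IsPolicy π Pr ℱ s h X) (T : ℕ)
    (n c : Fin N) : avgRate Pr X T n c ∈ Set.Icc 0 M.Rmax := by
  have h0 : ∀ τ, 0 ≤ ∫ ω, (X ω).R τ n c ∂Pr := fun τ =>
    integral_nonneg fun ω => ((hX.feasible ω).admission τ n c).1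
  have h1 : ∀ τ, ∫ ω, (X ω).R τ n c ∂Pr ≤ M.Rmax := fun τ => by
    have := integral_mono (hX.R_integrable τ n c) (integrable_const M.Rmax)
      fun ω => ((hX.feasible ω).admission τ n c).2
    simpa using this
  refine ⟨mul_nonneg (by positivity) (Finset.sum_nonneg fun τ _ => h0 τ), ?_⟩
  rcases Nat.eq_zero_or_pos T with rfl | hT
  · simpa [avgRate] using M.Rmax_nonneg
  · have hT' : (0 : ℝ) < T := by exact_mod_cast hT
    rw [avgRate, one_div, inv_mul_le_iff₀ hT']
    refine (Finset.sum_le_sum fun τ _ => h1 τ).trans ?_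
    simp

lemma IsPolicy.timeAvgRate_nonneg [IsProbabilityMeasure Pr] (hX : M.IsPolicy π Pr ℱ s h X)
    (n c : Fin N) : 0 ≤ timeAvgRate Pr X n c :=
  le_liminf_of_le (isBoundedUnder_of ⟨M.Rmax, fun T => (hX.avgRate_mem_Icc T n c).2⟩
    |>.isCoboundedUnder_ge) (Eventually.of_forall fun T => (hX.avgRate_mem_Icc T n c).1)

/-- The conditional averages, given the state, of the decisions of a stable policy up to a slot
`T` that is large and has small expected backlogs. -/
lemma IsPolicy.exists_isStationaryBound [Fintype S] [Fintype H] [IsProbabilityMeasure Pr]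
    (hX : M.IsPolicy π Pr ℱ s h X) (hstable : IsStable Pr X) {ε : ℝ} (hε : 0 < ε) :
    ∃ ρ f p, M.IsStationaryBound π (timeAvgRate Pr X) ε ρ f p := by
  have hst := hX.measurableSet_state
  have hq := hX.real_state
  obtain ⟨C, hC⟩ := hX.exists_integral_Q_le hstable
  have hev : ∀ᶠ T in atTop, ∀ n c, timeAvgRate Pr X n c - ε < avgRate Pr X T n c := by
    refine eventually_all.2 fun n => eventually_all.2 fun c => ?_
    exact eventually_lt_of_lt_liminf (sub_lt_self _ hε)
      (isBoundedUnder_of ⟨0, fun T => (hX.avgRate_mem_Icc T n c).1⟩)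
  obtain ⟨T₁, hT₁⟩ := eventually_atTop.1 hev
  obtain ⟨T, hT, hQT⟩ := hC (max (max T₁ ⌈C / ε⌉₊) 1)
  have hT1 : T₁ ≤ T := (le_max_left _ _).trans ((le_max_left _ _).trans hT)
  have hTC : ⌈C / ε⌉₊ ≤ T := (le_max_right _ _).trans ((le_max_left _ _).trans hT)
  have hT0 : T ≠ 0 := by have := (le_max_right _ _).trans hT; omega
  have hTpos : (0 : ℝ) < T := by exact_mod_cast Nat.pos_of_ne_zero hT0
  have hCT : C ≤ ε * T := by
    have := (Nat.le_ceil (C / ε)).trans (Nat.cast_le.2 hTC)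
    rwa [div_le_iff₀ hε, mul_comm] at this
  -- averages over the states of the conditional averages are plain time averages
  have hsum : ∀ (B : Finset ↥L) (g : ↥L → ℕ → Ω → ℝ), (∀ l τ, Integrable (g l τ) Pr) →
      ∑ z, (π z).toReal * ∑ l ∈ B, condAvg Pr (fun τ ω => (s τ ω, h τ ω))
        (fun z => (π z).toReal) T (g l) z =
      1 / (T : ℝ) * ∑ τ ∈ Finset.range T, ∫ ω, ∑ l ∈ B, g l τ ω ∂Pr := by
    intro B g hg
    rw [← sum_mul_condAvg (g := fun τ ω => ∑ l ∈ B, g l τ ω) hst hq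
      fun τ => integrable_finsetSum _ fun l _ => hg l τ]
    refine Finset.sum_congr rfl fun z _ => ?_
    rw [condAvg_sum hst B hg]
  refine ⟨avgRate Pr X T,
    fun z l c => condAvg Pr (fun τ ω => (s τ ω, h τ ω)) (fun z => (π z).toReal) T
      (fun τ ω => (X ω).flow τ l c) z,
    fun z l => condAvg Pr (fun τ ω => (s τ ω, h τ ω)) (fun z => (π z).toReal) T
      (fun τ ω => (X ω).P τ l) z, hX.timeAvgRate_nonneg, fun n c => ?_,
    fun n c => hX.avgRate_mem_Icc T n c, ?_, ?_, ?_⟩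
  · have := hT₁ T hT1 n c
    linarith
  · intro z hz a b K hK
    have hflow : ∀ l c τ, Integrable (fun ω => a l c * (X ω).flow τ l c) Pr :=
      fun l c τ => (hX.flow_integrable τ l c).const_mul _
    have hflow' : ∀ l τ, Integrable (fun ω => ∑ c, a l c * (X ω).flow τ l c) Pr :=
      fun l τ => integrable_finsetSum _ fun c _ => hflow l c τ
    have hP : ∀ l τ, Integrable (fun ω => b l * (X ω).P τ l) Pr :=
      fun l τ => (hX.P_integrable τ l).const_mul _
    simp only [← condAvg_const_mul]
    simp only [← condAvg_sum hst _ (hflow _)]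
    rw [← condAvg_sum hst _ hflow', ← condAvg_sum hst _ hP, ← condAvg_add hst
      (fun τ => integrable_finsetSum _ fun l _ => hflow' l τ)
      (fun τ => integrable_finsetSum _ fun l _ => hP l τ)]
    refine condAvg_le hst hq hT0 (fun τ => (integrable_finsetSum _ fun l _ => hflow' l τ).add
      (integrable_finsetSum _ fun l _ => hP l τ))
      (ENNReal.toReal_pos hz (π.apply_ne_top z)) fun τ ω hω => ?_
    have hf := hX.feasible ω
    have hs : s τ ω = z.1 := congrArg Prod.fst hω
    refine hK _ (hs ▸ (hf.power τ).1) _ (hf.flow_nonneg τ) fun l => ?_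
    rw [← hs]
    exact (Finset.sum_le_sum fun c _ => hf.flow_le τ l c).trans (hf.alloc_le τ l)
  · intro n c hnc
    simp only [mul_sub, Finset.sum_sub_distrib]
    simp only [inSum, outSum]
    rw [hsum _ (fun l τ ω => (X ω).flow τ l c) fun l τ => hX.flow_integrable τ l c,
      hsum _ (fun l τ ω => (X ω).flow τ l c) fun l τ => hX.flow_integrable τ l c, avgRate,
      ← mul_sub, ← mul_add, ← Finset.sum_sub_distrib, ← Finset.sum_add_distrib, one_div,
      inv_mul_le_iff₀ hTpos]
    refine le_trans (le_of_eq ?_) ((hQT n c).trans (hCT.trans_eq (mul_comm _ _)))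
    simp only [(hX.feasible _).Q_eq_sum hnc]
    have hdiff : ∀ τ, Integrable (fun ω => inSum (fun l => (X ω).flow τ l c) n
        - outSum (fun l => (X ω).flow τ l c) n) Pr := fun τ =>
      (hX.inSum_flow_integrable τ n c).sub (hX.outSum_flow_integrable τ n c)
    have hint : ∀ τ, Integrable (fun ω => inSum (fun l => (X ω).flow τ l c) n
        - outSum (fun l => (X ω).flow τ l c) n + (X ω).R τ n c) Pr := fun τ =>
      (hdiff τ).add (hX.R_integrable τ n c)
    rw [integral_finsetSum _ fun τ _ => hint τ]
    refine Finset.sum_congr rfl fun τ _ => ?_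
    rw [integral_add (hdiff τ) (hX.R_integrable τ n c),
      integral_sub (hX.inSum_flow_integrable τ n c) (hX.outSum_flow_integrable τ n c), add_comm]
    rfl
  · intro n
    simp only [outSum]
    rw [hsum _ (fun l τ ω => (X ω).P τ l) fun l τ => hX.P_integrable τ l, one_div,
      inv_mul_le_iff₀ hTpos]
    have hharv : ∀ τ, ∫ ω, M.harvest (h τ ω) n ∂Pr =
        ∑ z, (π z).toReal * M.harvest z.2 n := by
      intro τ
      have := hX.integral_mul_state (t := τ) (Z := fun _ => (1 : ℝ)) measurable_const
        (fun z => M.harvest z.2 n)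
      simpa using this
    have hint : ∀ τ, Integrable (fun ω => M.harvest (h τ ω) n) Pr := by
      intro τ
      let _ : MeasurableSpace (S × H) := ⊤
      refine .of_bound (C := M.hmax) ?_ (Eventually.of_forall fun ω => ?_)
      · have h1 : Measurable fun ω => (s τ ω, h τ ω) := (hX.state_meas τ).mono (ℱ.le _) le_rfl
        exact ((measurable_from_top (f := fun z : S × H => M.harvest z.2 n)).comp
          h1).aestronglyMeasurable
      · rw [Real.norm_of_nonneg (M.harvest_nonneg _ _)]
        exact M.harvest_le _ _
    have h2 : ∑ τ ∈ Finset.range T, ∫ ω, outSum ((X ω).P τ) n ∂Pr ≤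
        ∑ τ ∈ Finset.range T, ∫ ω, M.harvest (h τ ω) n ∂Pr := by
      rw [← integral_finsetSum _ fun τ _ => hX.outSum_P_integrable τ n,
        ← integral_finsetSum _ fun τ _ => hint τ]
      refine integral_mono (integrable_finsetSum _ fun τ _ => hX.outSum_P_integrable τ n)
        (integrable_finsetSum _ fun τ _ => hint τ) fun ω => ?_
      have h3 := (hX.feasible ω).E_nonneg T n
      rw [(hX.feasible ω).E_eq_sum, Finset.sum_sub_distrib] at h3
      have h4 := Finset.sum_le_sum fun τ (_ : τ ∈ Finset.range T) =>
        ((hX.feasible ω).harvesting τ n).2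
      dsimp only
      linarith
    refine h2.trans ?_
    simp [hharv]

end Policy

end EHNetwork

namespace EHNetwork

variable {N : ℕ} {L : Finset (Fin N × Fin N)} {S : Type u} {H : Type v}

/-! ### Lyapunov drift along a sample path -/

/-- The quadratic Lyapunov function: half the sum of the squared backlogs and of the squared
deviations of the batteries from the level `θ`. -/
noncomputable def lyapunov (θ : ℝ) (Q : Fin N → Fin N → ℝ) (E : Fin N → ℝ) : ℝ :=
  ∑ n, ∑ c, Q n c ^ 2 / 2 + ∑ n, (E n - θ) ^ 2 / 2

lemma lyapunov_nonneg (θ : ℝ) (Q : Fin N → Fin N → ℝ) (E : Fin N → ℝ) : 0 ≤ lyapunov θ Q E := by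
  unfold lyapunov
  positivity

/-- Out-degrees are not bounded by the maximum in-degree `d`, but they are at most `N` and
average at most `d`, which is why the squares sum to at most `N² d² K²`. -/
lemma sum_outSum_sq_le {y : ↥L → Fin N → ℝ} {K : ℝ} (hy : ∀ l c, 0 ≤ y l c)
    (hyK : ∀ l, ∑ c, y l c ≤ K) :
    ∑ n, ∑ c, outSum (fun l => y l c) n ^ 2 ≤ (N : ℝ) ^ 2 * (maxInDegree L : ℝ) ^ 2 * K ^ 2 := by
  set k : Fin N → ℕ := fun n => (Finset.univ.filter fun l : ↥L => l.1.1 = n).card with hk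
  have h1 : ∀ n, ∑ c, outSum (fun l => y l c) n ^ 2 ≤ N * K ^ 2 * k n := by
    intro n
    have h2 : ∑ c, outSum (fun l => y l c) n ^ 2 ≤ (∑ c, outSum (fun l => y l c) n) ^ 2 :=
      Finset.sum_sq_le_sq_sum_of_nonneg fun c _ => outSum_nonneg (fun l => hy l c) n
    have h3 : ∑ c, outSum (fun l => y l c) n ≤ k n * K := by
      simp only [outSum]
      rw [Finset.sum_comm]
      refine (Finset.sum_le_card_nsmul _ _ K fun l _ => hyK l).trans_eq ?_
      rw [nsmul_eq_mul]
    have h4 : 0 ≤ ∑ c, outSum (fun l => y l c) n :=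
      Finset.sum_nonneg fun c _ => outSum_nonneg (fun l => hy l c) n
    have h5 : (k n : ℝ) ≤ N := by exact_mod_cast card_outgoing_le n
    calc _ ≤ _ := h2
      _ ≤ (k n * K) ^ 2 := pow_le_pow_left₀ h4 h3 2
      _ = k n * (K ^ 2 * k n) := by ring
      _ ≤ N * (K ^ 2 * k n) := mul_le_mul_of_nonneg_right h5 (by positivity)
      _ = _ := by ring
  have h6 : ∑ n, k n ≤ N * maxInDegree L := by
    rw [← Finset.card_eq_sum_card_fiberwise (fun _ _ => by simp)]
    exact card_links_le
  have h7 : N * maxInDegree L ≤ N * maxInDegree L ^ 2 :=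
    Nat.mul_le_mul_left _ (Nat.le_self_pow two_ne_zero _)
  have h8 : ∑ n, (k n : ℝ) ≤ N * (maxInDegree L : ℝ) ^ 2 := by exact_mod_cast h6.trans h7
  calc _ ≤ ∑ n, N * K ^ 2 * (k n : ℝ) := Finset.sum_le_sum fun n _ => h1 n
    _ = N * K ^ 2 * ∑ n, (k n : ℝ) := by rw [Finset.mul_sum]
    _ ≤ N * K ^ 2 * (N * (maxInDegree L : ℝ) ^ 2) := by gcongr
    _ = _ := by ring

section Path

variable {M : EHNetwork L S H} {V : ℝ} {s : ℕ → S} {h : ℕ → H} {x : SamplePath L}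

lemma IsFeasible.Q_sq_le (hx : M.IsFeasible s h x) (t : ℕ) (n c : Fin N) :
    x.Q (t + 1) n c ^ 2 / 2 ≤ x.Q t n c ^ 2 / 2 + (outSum (fun l => x.alloc t l c) n ^ 2 / 2
      + ((maxInDegree L * M.μmax) ^ 2 + M.Rmax ^ 2))
      + (x.Q t n c * inSum (fun l => x.alloc t l c) n - x.Q t n c * outSum (fun l => x.alloc t l c) n
        + x.Q t n c * x.R t n c) := by
  by_cases hnc : n = c
  · subst hnc
    rw [hx.Q_dest, hx.Q_dest]
    simp only [zero_mul, sub_zero, add_zero, ne_eq, OfNat.ofNat_ne_zero, not_false_eq_true,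
      zero_pow, zero_div, zero_add]
    positivity
  rw [hx.Q_step t n c hnc]
  have hQ := hx.Q_nonneg t n c
  have hR := hx.admission t n c
  have ha : 0 ≤ outSum (fun l => x.alloc t l c) n := outSum_nonneg (fun l => hx.alloc_nonneg t l c) n
  have hb : 0 ≤ inSum (fun l => x.flow t l c) n := inSum_nonneg (fun l => hx.flow_nonneg t l c) n
  have hbb : inSum (fun l => x.flow t l c) n ≤ inSum (fun l => x.alloc t l c) n :=
    inSum_mono (fun l => hx.flow_le t l c) n
  have hbm : inSum (fun l => x.alloc t l c) n ≤ maxInDegree L * M.μmax :=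
    inSum_le_of_le M.μmax_nonneg (fun l => hx.alloc_le_μmax t l c) n
  generalize outSum (fun l => x.alloc t l c) n = a at *
  generalize inSum (fun l => x.flow t l c) n = b at *
  generalize inSum (fun l => x.alloc t l c) n = b' at *
  generalize x.Q t n c = q at *
  generalize x.R t n c = R at *
  have h1 : max (q - a) 0 ^ 2 ≤ (q - a) ^ 2 := by
    rcases le_total (q - a) 0 with h | h
    · rw [max_eq_right h]; simpa using sq_nonneg (q - a)
    · rw [max_eq_left h]
  have h2 : max (q - a) 0 * (b + R) ≤ q * (b + R) :=
    mul_le_mul_of_nonneg_right (max_le (by linarith) hQ) (add_nonneg hb hR.1)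
  have h3 : b ^ 2 ≤ (maxInDegree L * M.μmax) ^ 2 := pow_le_pow_left₀ hb (hbb.trans hbm) 2
  have h4 : R ^ 2 ≤ M.Rmax ^ 2 := pow_le_pow_left₀ hR.1 hR.2 2
  have h5 : q * b ≤ q * b' := mul_le_mul_of_nonneg_left hbb hQ
  nlinarith [sq_nonneg (b - R)]

lemma IsFeasible.E_sq_le (hx : M.IsFeasible s h x) (θ : ℝ) (t : ℕ) (n : Fin N) :
    (x.E (t + 1) n - θ) ^ 2 / 2 ≤ (x.E t n - θ) ^ 2 / 2 + (M.Pmax + M.hmax) ^ 2 / 2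
      + ((x.E t n - θ) * x.e t n - (x.E t n - θ) * outSum (x.P t) n) := by
  rw [hx.E_step]
  have hP0 := outSum_nonneg (fun l => M.power_nonneg _ _ (hx.power t).1 l) n
  have hP1 : outSum (x.P t) n ≤ M.Pmax := M.power_le _ _ (hx.power t).1 n
  have he := hx.harvesting t n
  have hh := M.harvest_le (h t) n
  have hh0 := M.hmax_nonneg
  have h1 : (x.e t n - outSum (x.P t) n) ^ 2 ≤ (M.Pmax + M.hmax) ^ 2 :=
    sq_le_sq' (by linarith) (by linarith)
  nlinarith

/-- The one-slot drift: the second-order terms are at most `B`. -/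
lemma IsFeasible.drift_le (hx : M.IsFeasible s h x) (θ : ℝ) (t : ℕ) :
    lyapunov θ (x.Q (t + 1)) (x.E (t + 1)) - lyapunov θ (x.Q t) (x.E t) ≤ M.B
      - ∑ l : ↥L, ∑ c, x.alloc t l c * (x.Q t l.1.1 c - x.Q t l.1.2 c)
      + ∑ n, ∑ c, x.Q t n c * x.R t n c + ∑ n, (x.E t n - θ) * x.e t n
      - ∑ l : ↥L, (x.E t l.1.1 - θ) * x.P t l := by
  have h1 := Finset.sum_le_sum fun n (_ : n ∈ Finset.univ) =>
    Finset.sum_le_sum fun c (_ : c ∈ Finset.univ) => hx.Q_sq_le t n c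
  have h2 := Finset.sum_le_sum fun n (_ : n ∈ Finset.univ) => hx.E_sq_le θ t n
  simp only [Finset.sum_add_distrib, Finset.sum_sub_distrib, Finset.sum_const, Finset.card_univ,
    Fintype.card_fin, nsmul_eq_mul] at h1 h2
  have h3 : ∑ n, ∑ c, outSum (fun l => x.alloc t l c) n ^ 2 / 2 ≤
      (N : ℝ) ^ 2 * (maxInDegree L : ℝ) ^ 2 * M.μmax ^ 2 / 2 := by
    simp only [← Finset.sum_div]
    exact div_le_div_of_nonneg_right (sum_outSum_sq_le (hx.alloc_nonneg t)
      fun l => (hx.alloc_le t l).trans (M.rate_le _ _ (hx.power t).1 l)) two_pos.le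
  rw [sum_mul_outSum (fun n => x.E t n - θ)] at h2
  rw [sum_mul_backlog_sub]
  simp only [lyapunov, B]
  nlinarith

/-- ESA transmits at least as much weighted rate as the objective credits to its powers; the
offset `γ` in the weights only helps. -/
lemma IsESA.sum_rate_mul_linkWeight_le {θ : Fin N → ℝ} (hx : M.IsESA V θ s h x) (t : ℕ) :
    ∑ l : ↥L, M.rate (s t) (x.P t) l * M.linkWeight (x.Q t) l ≤
      ∑ l : ↥L, ∑ c, x.alloc t l c * (x.Q t l.1.1 c - x.Q t l.1.2 c) := by
  refine Finset.sum_le_sum fun l _ => ?_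
  obtain ⟨c', hmax, hpos, hzero, hother⟩ := hx.routing t l
  rw [M.linkWeight_eq _ l c' hmax, Finset.sum_eq_single c'
    (fun c _ hc => by rw [hother c hc, zero_mul]) (fun hc => absurd (Finset.mem_univ _) hc)]
  rcases lt_or_ge 0 (M.weight (x.Q t) l c') with hw | hw
  · rw [hpos hw]
    refine mul_le_mul_of_nonneg_left ?_ (M.rate_nonneg _ _ (hx.feasible.power t).1 l)
    have hγ := M.γ_nonneg
    simp only [weight] at hw ⊢
    rcases lt_max_iff.1 hw with h | h
    · exact max_le (by linarith) (by linarith)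
    · exact absurd h (lt_irrefl _)
  · rw [hzero hw, le_antisymm hw (le_max_right _ _)]
    simp

lemma IsESA.sum_mul_e_eq {θ : ℝ} (hx : M.IsESA V (fun _ => θ) s h x) (t : ℕ) :
    ∑ n, (x.E t n - θ) * x.e t n = ∑ n, min (x.E t n - θ) 0 * M.harvest (h t) n := by
  refine Finset.sum_congr rfl fun n _ => ?_
  rcases lt_or_ge (x.E t n - θ) 0 with hE | hE
  · rw [(hx.harvesting t n).1 hE, min_eq_left hE.le]
  · rw [(hx.harvesting t n).2 hE, min_eq_right hE]; simp

lemma IsESA.admission_ge {θ : Fin N → ℝ} (hx : M.IsESA V θ s h x) (t : ℕ)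
    {ρ : Fin N → Fin N → ℝ} (hρ : ∀ n c, 0 ≤ ρ n c ∧ ρ n c ≤ M.Rmax) :
    V * M.Utot ρ - ∑ n, ∑ c, x.Q t n c * ρ n c ≤
      V * M.Utot (x.R t) - ∑ n, ∑ c, x.Q t n c * x.R t n c := by
  simp only [Utot, Finset.mul_sum, ← Finset.sum_sub_distrib]
  exact Finset.sum_le_sum fun n _ => Finset.sum_le_sum fun c _ =>
    isMaxOn_iff.1 (hx.admission t n c) _ (hρ n c)

variable [Fintype S] [Fintype H] {π : PMF (S × H)} {r : Fin N → Fin N → ℝ} {ε : ℝ}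
  {ρ : Fin N → Fin N → ℝ} {f : S × H → ↥L → Fin N → ℝ} {p : S × H → ↥L → ℝ}

lemma IsStationaryBound.sum_flow_le (hs : M.IsStationaryBound π r ε ρ f p) {z : S × H}
    (hz : π z ≠ 0) : ∑ l, ∑ c, f z l c ≤ N * maxInDegree L * M.μmax := by
  have h1 := hs.feasible z hz (fun _ _ => 1) (fun _ => 0) (N * maxInDegree L * M.μmax) ?_
  · simpa using h1
  intro q hq y hy hyq
  simp only [one_mul, zero_mul, Finset.sum_const_zero, add_zero]
  refine (Finset.sum_le_card_nsmul _ _ M.μmax fun l _ =>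
    (hyq l).trans (M.rate_le _ _ hq l)).trans ?_
  rw [nsmul_eq_mul, Finset.card_univ]
  exact mul_le_mul_of_nonneg_right (by exact_mod_cast card_links_le) M.μmax_nonneg

lemma IsStationaryBound.outSum_power_nonneg (hs : M.IsStationaryBound π r ε ρ f p) (n : Fin N) :
    0 ≤ ∑ z, (π z).toReal * outSum (p z) n := by
  refine Finset.sum_nonneg fun z _ => ?_
  by_cases hz : π z = 0
  · simp [hz]
  refine mul_nonneg ENNReal.toReal_nonneg (outSum_nonneg (fun l => ?_) n)
  classical
  have h1 := hs.feasible z hz (fun _ _ => 0) (fun l' => if l' = l then -1 else 0) 0 ?_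
  · simpa using h1
  intro q hq y _ _
  simpa using M.power_nonneg _ _ hq l

/-- The powers of ESA are worth at least as much as those of the stationary bound in the same
state, because they maximize the objective over all feasible power vectors. -/
lemma IsESA.powerObjective_ge (hx : M.IsESA V (fun _ => M.θ V) s h x) (hV : 0 ≤ V)
    (hs : M.IsStationaryBound π r ε ρ f p) (t : ℕ) (hz : π (s t, h t) ≠ 0) :
    ∑ l : ↥L, ∑ c, (x.Q t l.1.1 c - x.Q t l.1.2 c - M.γ) * f (s t, h t) l c
      + ∑ l : ↥L, (x.E t l.1.1 - M.θ V) * p (s t, h t) l ≤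
    M.powerObjective (fun _ => M.θ V) (s t) (x.Q t) (x.E t) (x.P t) := by
  refine hs.feasible _ hz (fun l c => x.Q t l.1.1 c - x.Q t l.1.2 c - M.γ)
    (fun l => x.E t l.1.1 - M.θ V) _ fun q hq y hy hyq => ?_
  refine le_trans ?_ (isMaxOn_iff.1 (hx.isMaxOn_powerSet hV t) q hq)
  rw [powerObjective_eq, Finset.sum_add_distrib]
  gcongr with l
  calc ∑ c, (x.Q t l.1.1 c - x.Q t l.1.2 c - M.γ) * y l c
      ≤ ∑ c, M.linkWeight (x.Q t) l * y l c :=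
        Finset.sum_le_sum fun c _ => mul_le_mul_of_nonneg_right
          ((le_max_left _ _).trans (M.weight_le_linkWeight (x.Q t) l c)) (hy l c)
    _ = (∑ c, y l c) * M.linkWeight (x.Q t) l := by rw [← Finset.mul_sum, mul_comm]
    _ ≤ _ := mul_le_mul_of_nonneg_right (hyq l) (M.linkWeight_nonneg _ l)

/-- The drift-plus-penalty inequality: ESA against the stationary bound. -/
lemma IsESA.drift_plus_penalty_le (hx : M.IsESA V (fun _ => M.θ V) s h x) (hV : 0 ≤ V)
    (hs : M.IsStationaryBound π r ε ρ f p) (t : ℕ) (hz : π (s t, h t) ≠ 0) :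
    lyapunov (M.θ V) (x.Q (t + 1)) (x.E (t + 1)) - lyapunov (M.θ V) (x.Q t) (x.E t) ≤
      M.Btilde + V * M.Utot (x.R t) - V * M.Utot ρ
      + (∑ n, ∑ c, (x.Q t n c * ρ n c + x.Q t n c * (inSum (fun l => f (s t, h t) l c) n
          - outSum (fun l => f (s t, h t) l c) n))
        + ∑ n, (min (x.E t n - M.θ V) 0 * M.harvest (h t) n
          - (x.E t n - M.θ V) * outSum (p (s t, h t)) n)) := by
  have h1 := hx.feasible.drift_le (M.θ V) t
  have h2 := hx.sum_rate_mul_linkWeight_le t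
  have h3 := hx.powerObjective_ge hV hs t hz
  have h4 := hx.sum_mul_e_eq t
  have h5 := hx.admission_ge t hs.admission
  have h6 := mul_le_mul_of_nonneg_left (hs.sum_flow_le hz) M.γ_nonneg
  rw [powerObjective_eq, Finset.sum_add_distrib] at h3
  have h7 : ∑ l : ↥L, ∑ c, (x.Q t l.1.1 c - x.Q t l.1.2 c - M.γ) * f (s t, h t) l c =
      ∑ l : ↥L, ∑ c, f (s t, h t) l c * (x.Q t l.1.1 c - x.Q t l.1.2 c)
        - M.γ * ∑ l, ∑ c, f (s t, h t) l c := by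
    simp only [Finset.mul_sum, ← Finset.sum_sub_distrib]
    exact Finset.sum_congr rfl fun l _ => Finset.sum_congr rfl fun c _ => by ring
  rw [h7, sum_mul_backlog_sub] at h3
  simp only [mul_sub, Finset.sum_add_distrib, Finset.sum_sub_distrib]
  rw [sum_mul_outSum (fun n => x.E t n - M.θ V), Btilde]
  nlinarith

end Path

end EHNetwork

namespace EHNetwork

variable {N : ℕ} {L : Finset (Fin N × Fin N)} {S : Type u} {H : Type v}

/-! ### Expected drift under ESA -/

section Expectation

variable {M : EHNetwork L S H} {V : ℝ} {π : PMF (S × H)} {Ω : Type w} [mΩ : MeasurableSpace Ω]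
  {Pr : Measure Ω} {ℱ : Filtration ℕ mΩ} {s : ℕ → Ω → S} {h : ℕ → Ω → H} {X : Ω → SamplePath L}

lemma IsPolicy.integrable_mul_state [Fintype S] [Fintype H] (hX : M.IsPolicy π Pr ℱ s h X)
    (t : ℕ) {Z : Ω → ℝ} (hZ : Integrable Z Pr) (φ : S × H → ℝ) :
    Integrable (fun ω => Z ω * φ (s t ω, h t ω)) Pr := by
  let _ : MeasurableSpace (S × H) := ⊤
  have hst : Measurable fun ω => (s t ω, h t ω) := (hX.state_meas t).mono (ℱ.le _) le_rfl
  refine hZ.mul_bdd (c := ∑ z, |φ z|)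
    ((measurable_from_top (f := φ)).comp hst).aestronglyMeasurable
    (Eventually.of_forall fun ω => ?_)
  exact Finset.single_le_sum (f := fun z => |φ z|) (fun _ _ => abs_nonneg _) (Finset.mem_univ _)

lemma IsPolicy.Q_measurable (hX : M.IsPolicy π Pr ℱ s h X) (t : ℕ) (n c : Fin N) :
    Measurable fun ω => (X ω).Q t n c :=
  (hX.Q_meas t n c).mono (ℱ.le t) le_rfl

lemma IsPolicy.E_measurable (hX : M.IsPolicy π Pr ℱ s h X) (t : ℕ) (n : Fin N) :
    Measurable fun ω => (X ω).E t n :=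
  (hX.E_meas t n).mono (ℱ.le t) le_rfl

lemma IsPolicy.ae_state (hX : M.IsPolicy π Pr ℱ s h X) [Finite S] [Finite H] (t : ℕ) :
    ∀ᵐ ω ∂Pr, π (s t ω, h t ω) ≠ 0 := by
  have h1 : ∀ z, π z = 0 → ∀ᵐ ω ∂Pr, (s t ω, h t ω) ≠ z := by
    intro z hz
    have h2 : Pr {ω | (s t ω, h t ω) = z} = 0 := by
      rw [← hz, ← hX.state_law t z.1 z.2]
      simp [Prod.ext_iff]
    exact measure_eq_zero_iff_ae_notMem.1 h2
  have h2 : ∀ᵐ ω ∂Pr, ∀ z, π z = 0 → (s t ω, h t ω) ≠ z := by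
    rw [ae_all_iff]
    exact fun z => ae_all_iff.2 fun hz => h1 z hz
  filter_upwards [h2] with ω hω hz
  exact hω _ hz rfl

variable [IsProbabilityMeasure Pr]

lemma IsPolicy.E_integrable (hX : M.IsPolicy π Pr ℱ s h X)
    (hesa : ∀ ω, M.IsESA V (fun _ => M.θ V) (fun t => s t ω) (fun t => h t ω) (X ω))
    (hV : 0 ≤ V) (t : ℕ) (n : Fin N) : Integrable (fun ω => (X ω).E t n) Pr := by
  refine .of_bound (C := M.θ V + M.hmax) (hX.E_measurable t n).aestronglyMeasurable
    (Eventually.of_forall fun ω => ?_)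
  rw [Real.norm_of_nonneg ((hesa ω).feasible.E_nonneg t n)]
  exact (hesa ω).E_le hV t n

lemma IsPolicy.U_R_integrable (hX : M.IsPolicy π Pr ℱ s h X) (t : ℕ) (n c : Fin N) :
    Integrable (fun ω => M.U n c ((X ω).R t n c)) Pr := by
  have hR := fun ω => (hX.feasible ω).admission t n c
  have hcont : Continuous fun r : ℝ => M.U n c (max r 0) :=
    (M.U_contDiff n c).continuousOn.comp_continuous (by fun_prop) fun r =>
      Set.mem_Ici.2 (le_max_right _ _)
  have hmeas : Measurable fun ω => M.U n c ((X ω).R t n c) := by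
    have h1 := hcont.measurable.comp ((hX.R_meas t n c).mono (ℱ.le _) le_rfl)
    refine (congrArg Measurable (funext fun ω => ?_)).mp h1
    simp only [Function.comp_apply, max_eq_left (hR ω).1]
  refine .of_bound (C := M.U n c M.Rmax) hmeas.aestronglyMeasurable
    (Eventually.of_forall fun ω => ?_)
  rw [Real.norm_of_nonneg (M.U_nonneg n c (hR ω).1)]
  exact M.U_mono n c (hR ω).1 (hR ω).2

lemma IsPolicy.Utot_R_integrable (hX : M.IsPolicy π Pr ℱ s h X) (t : ℕ) :
    Integrable (fun ω => M.Utot ((X ω).R t)) Pr :=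
  integrable_finsetSum _ fun n _ => integrable_finsetSum _ fun c _ => hX.U_R_integrable t n c

lemma IsPolicy.lyapunov_integrable (hX : M.IsPolicy π Pr ℱ s h X)
    (hesa : ∀ ω, M.IsESA V (fun _ => M.θ V) (fun t => s t ω) (fun t => h t ω) (X ω))
    (hV : 0 ≤ V) (t : ℕ) :
    Integrable (fun ω => lyapunov (M.θ V) ((X ω).Q t) ((X ω).E t)) Pr := by
  unfold lyapunov
  refine (integrable_finsetSum _ fun n _ => integrable_finsetSum _ fun c _ => ?_).add
    (integrable_finsetSum _ fun n _ => ?_)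
  · refine .of_bound (C := (M.β * V + M.Rmax) ^ 2 / 2)
      (((hX.Q_measurable t n c).pow_const 2).div_const 2).aestronglyMeasurable
      (Eventually.of_forall fun ω => ?_)
    rw [Real.norm_of_nonneg (by positivity)]
    have := pow_le_pow_left₀ ((hesa ω).feasible.Q_nonneg t n c) ((hesa ω).Q_le hV t n c) 2
    linarith
  · refine .of_bound (C := (M.θ V + M.hmax) ^ 2 / 2)
      ((((hX.E_measurable t n).sub_const _).pow_const 2).div_const 2).aestronglyMeasurable
      (Eventually.of_forall fun ω => ?_)
    rw [Real.norm_of_nonneg (by positivity)]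
    have h1 := (hesa ω).feasible.E_nonneg t n
    have h2 := (hesa ω).E_le hV t n
    have h3 := M.hmax_nonneg
    have h4 : 0 ≤ M.θ V := M.Pmax_nonneg.trans (M.Pmax_le_θ hV)
    have : ((X ω).E t n - M.θ V) ^ 2 ≤ (M.θ V + M.hmax) ^ 2 :=
      sq_le_sq' (by linarith) (by linarith)
    linarith

/-- Jensen's inequality, over the probability space and over time. -/
lemma IsPolicy.avg_Utot_le (hX : M.IsPolicy π Pr ℱ s h X) {T : ℕ} (hT : T ≠ 0) :
    1 / (T : ℝ) * ∑ τ ∈ Finset.range T, ∫ ω, M.Utot ((X ω).R τ) ∂Pr ≤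
      M.Utot (avgRate Pr X T) := by
  have hT' : (T : ℝ) ≠ 0 := Nat.cast_ne_zero.2 hT
  have h1 : ∀ n c, 1 / (T : ℝ) * ∑ τ ∈ Finset.range T, ∫ ω, M.U n c ((X ω).R τ n c) ∂Pr ≤
      M.U n c (avgRate Pr X T n c) := by
    intro n c
    have hconc := (M.U_strictConcave n c).concaveOn
    have h2 : ∀ τ, ∫ ω, M.U n c ((X ω).R τ n c) ∂Pr ≤ M.U n c (∫ ω, (X ω).R τ n c ∂Pr) :=
      fun τ => hconc.le_map_integral (M.U_contDiff n c).continuousOn isClosed_Ici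
        (Eventually.of_forall fun ω => ((hX.feasible ω).admission τ n c).1)
        (hX.R_integrable τ n c) (hX.U_R_integrable τ n c)
    have h3 := hconc.le_map_sum (t := Finset.range T) (w := fun _ => 1 / (T : ℝ))
      (p := fun τ => ∫ ω, (X ω).R τ n c ∂Pr) (fun _ _ => by positivity)
      (by simp [hT'])
      (fun τ _ => Set.mem_Ici.2 <| integral_nonneg fun ω => ((hX.feasible ω).admission τ n c).1)
    simp only [smul_eq_mul, ← Finset.mul_sum] at h3
    refine le_trans ?_ h3
    exact mul_le_mul_of_nonneg_left (Finset.sum_le_sum fun τ _ => h2 τ) (by positivity)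
  calc _ = ∑ n, ∑ c, 1 / (T : ℝ) * ∑ τ ∈ Finset.range T, ∫ ω, M.U n c ((X ω).R τ n c) ∂Pr := by
        simp only [← Finset.mul_sum]
        congr 1
        simp only [Finset.sum_comm (s := Finset.univ) (t := Finset.range T)]
        refine Finset.sum_congr rfl fun τ _ => ?_
        simp only [Utot]
        rw [integral_finsetSum _ fun n _ =>
          integrable_finsetSum Finset.univ fun c _ => hX.U_R_integrable τ n c]
        exact Finset.sum_congr rfl fun n _ =>
          integral_finsetSum _ fun c _ => hX.U_R_integrable τ n c
    _ ≤ _ := Finset.sum_le_sum fun n _ => Finset.sum_le_sum fun c _ => h1 n c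

variable [Fintype S] [Fintype H] {r : Fin N → Fin N → ℝ} {ε : ℝ}
  {ρ : Fin N → Fin N → ℝ} {f : S × H → ↥L → Fin N → ℝ} {p : S × H → ↥L → ℝ}

lemma IsPolicy.integral_backlog_term_le (hX : M.IsPolicy π Pr ℱ s h X)
    (hesa : ∀ ω, M.IsESA V (fun _ => M.θ V) (fun t => s t ω) (fun t => h t ω) (X ω))
    (hV : 0 ≤ V) (hε : 0 ≤ ε) (hs : M.IsStationaryBound π r ε ρ f p) (t : ℕ) (n c : Fin N) :
    ∫ ω, ((X ω).Q t n c * ρ n c + (X ω).Q t n c *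
      (inSum (fun l => f (s t ω, h t ω) l c) n - outSum (fun l => f (s t ω, h t ω) l c) n)) ∂Pr
      ≤ (M.β * V + M.Rmax) * ε := by
  have hK : 0 ≤ (M.β * V + M.Rmax) * ε :=
    mul_nonneg (add_nonneg (mul_nonneg M.β_nonneg hV) M.Rmax_nonneg) hε
  have hQ := hX.Q_integrable t n c
  rw [integral_add (hQ.mul_const _) (hX.integrable_mul_state t hQ
    fun z => inSum (fun l => f z l c) n - outSum (fun l => f z l c) n), integral_mul_const,
    hX.integral_mul_state (hX.Q_meas t n c)
      fun z => inSum (fun l => f z l c) n - outSum (fun l => f z l c) n, ← mul_add]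
  by_cases hnc : n = c
  · subst hnc
    simpa [(hX.feasible _).Q_dest] using hK
  have h0 : 0 ≤ ∫ ω, (X ω).Q t n c ∂Pr :=
    integral_nonneg fun ω => (hX.feasible ω).Q_nonneg t n c
  have h1 : ∫ ω, (X ω).Q t n c ∂Pr ≤ M.β * V + M.Rmax := by
    have := integral_mono hQ (integrable_const (M.β * V + M.Rmax))
      fun ω => (hesa ω).Q_le hV t n c
    simpa using this
  exact (mul_le_mul_of_nonneg_left (hs.balance n c hnc) h0).trans
    (mul_le_mul_of_nonneg_right h1 hε)

/-- With a full battery ESA does not harvest and the consumption of the stationary bound counts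
in its favour; otherwise ESA harvests all it can, on average no less than that consumption. -/
lemma IsPolicy.integral_battery_term_le (hX : M.IsPolicy π Pr ℱ s h X)
    (hesa : ∀ ω, M.IsESA V (fun _ => M.θ V) (fun t => s t ω) (fun t => h t ω) (X ω))
    (hV : 0 ≤ V) (hs : M.IsStationaryBound π r ε ρ f p) (t : ℕ) (n : Fin N) :
    Integrable (fun ω => min ((X ω).E t n - M.θ V) 0 * M.harvest (h t ω) n
      - ((X ω).E t n - M.θ V) * outSum (p (s t ω, h t ω)) n) Pr ∧
    ∫ ω, (min ((X ω).E t n - M.θ V) 0 * M.harvest (h t ω) n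
      - ((X ω).E t n - M.θ V) * outSum (p (s t ω, h t ω)) n) ∂Pr ≤ 0 := by
  have hE : Integrable (fun ω => (X ω).E t n - M.θ V) Pr :=
    (hX.E_integrable hesa hV t n).sub (integrable_const _)
  have hmin : Integrable (fun ω => min ((X ω).E t n - M.θ V) 0) Pr :=
    hE.inf (integrable_const 0)
  have hEm : Measurable[ℱ t] fun ω => (X ω).E t n - M.θ V := (hX.E_meas t n).sub_const _
  have hminm : Measurable[ℱ t] fun ω => min ((X ω).E t n - M.θ V) 0 := hEm.min measurable_const
  have hi1 := hX.integrable_mul_state t hmin fun z => M.harvest z.2 n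
  have hi2 := hX.integrable_mul_state t hE fun z => outSum (p z) n
  refine ⟨hi1.sub hi2, ?_⟩
  rw [integral_sub hi1 hi2, hX.integral_mul_state hminm fun z => M.harvest z.2 n,
    hX.integral_mul_state hEm fun z => outSum (p z) n]
  have h1 := hs.energy n
  have h2 := hs.outSum_power_nonneg n
  have h3 : ∫ ω, min ((X ω).E t n - M.θ V) 0 ∂Pr ≤ 0 :=
    integral_nonpos fun ω => min_le_right _ _
  have h4 : ∫ ω, min ((X ω).E t n - M.θ V) 0 ∂Pr ≤ ∫ ω, ((X ω).E t n - M.θ V) ∂Pr :=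
    integral_mono hmin hE fun ω => min_le_left _ _
  have h5 := mul_le_mul_of_nonpos_left h1 h3
  have h6 := mul_le_mul_of_nonneg_right h4 h2
  linarith

lemma IsPolicy.integral_drift_le (hX : M.IsPolicy π Pr ℱ s h X)
    (hesa : ∀ ω, M.IsESA V (fun _ => M.θ V) (fun t => s t ω) (fun t => h t ω) (X ω))
    (hV : 0 ≤ V) (hε : 0 ≤ ε) (hs : M.IsStationaryBound π r ε ρ f p) (t : ℕ) :
    ∫ ω, lyapunov (M.θ V) ((X ω).Q (t + 1)) ((X ω).E (t + 1)) ∂Pr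
      - ∫ ω, lyapunov (M.θ V) ((X ω).Q t) ((X ω).E t) ∂Pr ≤
    M.Btilde + V * ∫ ω, M.Utot ((X ω).R t) ∂Pr - V * M.Utot ρ
      + (N : ℝ) ^ 2 * ((M.β * V + M.Rmax) * ε) := by
  have hL := hX.lyapunov_integrable hesa hV
  have hU := hX.Utot_R_integrable t
  have hQterm : ∀ n c, Integrable (fun ω => (X ω).Q t n c * ρ n c + (X ω).Q t n c *
      (inSum (fun l => f (s t ω, h t ω) l c) n - outSum (fun l => f (s t ω, h t ω) l c) n)) Pr :=
    fun n c => ((hX.Q_integrable t n c).mul_const _).add (hX.integrable_mul_state t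
      (hX.Q_integrable t n c) fun z => inSum (fun l => f z l c) n - outSum (fun l => f z l c) n)
  have hQsum := integrable_finsetSum Finset.univ fun n _ =>
    integrable_finsetSum Finset.univ fun c _ => hQterm n c
  have hEterm := fun n => (hX.integral_battery_term_le hesa hV hs t n).1
  have hEsum := integrable_finsetSum Finset.univ fun n _ => hEterm n
  have hpen : Integrable (fun ω => M.Btilde + V * M.Utot ((X ω).R t) - V * M.Utot ρ) Pr :=
    ((integrable_const _).add (hU.const_mul V)).sub (integrable_const _)
  have hmono := integral_mono_ae ((hL (t + 1)).sub (hL t)) (hpen.add (hQsum.add hEsum)) (by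
    filter_upwards [hX.ae_state t] with ω hω
    exact (hesa ω).drift_plus_penalty_le hV hs t hω)
  have hA : ∫ ω, (M.Btilde + V * M.Utot ((X ω).R t) - V * M.Utot ρ) ∂Pr =
      M.Btilde + V * ∫ ω, M.Utot ((X ω).R t) ∂Pr - V * M.Utot ρ := by
    rw [integral_sub (by fun_prop) (integrable_const _), integral_add (integrable_const _)
      (hU.const_mul V), integral_const_mul]
    simp
  have hB : ∫ ω, ∑ n, ∑ c, ((X ω).Q t n c * ρ n c + (X ω).Q t n c *
      (inSum (fun l => f (s t ω, h t ω) l c) n - outSum (fun l => f (s t ω, h t ω) l c) n)) ∂Pr ≤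
      (N : ℝ) ^ 2 * ((M.β * V + M.Rmax) * ε) := by
    rw [integral_finsetSum _ fun n _ => integrable_finsetSum Finset.univ fun c _ => hQterm n c]
    refine (Finset.sum_le_sum (g := fun _ => N * ((M.β * V + M.Rmax) * ε)) fun n _ => ?_).trans_eq
      (by simp [sq, mul_assoc])
    rw [integral_finsetSum _ fun c _ => hQterm n c]
    exact (Finset.sum_le_sum fun c _ =>
      hX.integral_backlog_term_le hesa hV hε hs t n c).trans_eq (by simp)
  have hC : ∫ ω, ∑ n, (min ((X ω).E t n - M.θ V) 0 * M.harvest (h t ω) n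
      - ((X ω).E t n - M.θ V) * outSum (p (s t ω, h t ω)) n) ∂Pr ≤ 0 := by
    rw [integral_finsetSum _ fun n _ => hEterm n]
    exact Finset.sum_nonpos fun n _ => (hX.integral_battery_term_le hesa hV hs t n).2
  rw [integral_sub' (hL (t + 1)) (hL t), integral_add' hpen (hQsum.add hEsum),
    integral_add' hQsum hEsum] at hmono
  linarith

/-! ### Utility of the time averages -/

/-- Telescoping the expected drift; the initial value `C` of the Lyapunov function is washed out
by the factor `1 / T`. -/
lemma IsPolicy.Utot_avgRate_ge (hX : M.IsPolicy π Pr ℱ s h X)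
    (hesa : ∀ ω, M.IsESA V (fun _ => M.θ V) (fun t => s t ω) (fun t => h t ω) (X ω))
    (hV : 0 < V) (hε : 0 ≤ ε) (hs : M.IsStationaryBound π r ε ρ f p) {T : ℕ} (hT : T ≠ 0) :
    M.Utot ρ - (M.Btilde + (N : ℝ) ^ 2 * ((M.β * V + M.Rmax) * ε)) / V
      - (∫ ω, lyapunov (M.θ V) ((X ω).Q 0) ((X ω).E 0) ∂Pr) / V * (1 / (T : ℝ)) ≤
    M.Utot (avgRate Pr X T) := by
  refine le_trans ?_ (hX.avg_Utot_le hT)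
  set D := M.Btilde + (N : ℝ) ^ 2 * ((M.β * V + M.Rmax) * ε) with hD
  set ℓ : ℕ → ℝ := fun t => ∫ ω, lyapunov (M.θ V) ((X ω).Q t) ((X ω).E t) ∂Pr with hℓ
  have hTpos : (0 : ℝ) < T := by exact_mod_cast Nat.pos_of_ne_zero hT
  have h1 : ∑ t ∈ Finset.range T, (ℓ (t + 1) - ℓ t) ≤
      ∑ t ∈ Finset.range T, (D - V * M.Utot ρ + V * ∫ ω, M.Utot ((X ω).R t) ∂Pr) :=
    Finset.sum_le_sum fun t _ => by
      have := hX.integral_drift_le hesa hV.le hε hs t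
      simp only [hℓ, hD]
      linarith
  rw [Finset.sum_range_sub, Finset.sum_add_distrib, ← Finset.mul_sum] at h1
  simp only [Finset.sum_const, Finset.card_range, nsmul_eq_mul] at h1
  have h2 : 0 ≤ ℓ T := integral_nonneg fun ω => lyapunov_nonneg _ _ _
  have h3 : M.Utot ρ - D / V - ℓ 0 / V * (1 / (T : ℝ)) =
      1 / (T : ℝ) * ((T * (V * M.Utot ρ - D) - ℓ 0) / V) := by
    field_simp
  rw [show (∫ ω, lyapunov (M.θ V) ((X ω).Q 0) ((X ω).E 0) ∂Pr) = ℓ 0 from rfl, h3]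
  refine mul_le_mul_of_nonneg_left ?_ (by positivity)
  rw [div_le_iff₀ hV]
  nlinarith

lemma IsStationaryBound.Utot_le (hs : M.IsStationaryBound π r ε ρ f p) (hε : 0 ≤ ε) :
    M.Utot r ≤ M.Utot ρ + (N : ℝ) ^ 2 * (M.β * ε) := by
  have h1 : ∀ n c, M.U n c (r n c) ≤ M.U n c (ρ n c) + M.β * ε := fun n c =>
    (M.U_mono n c (hs.rate_nonneg n c) (hs.rate_le n c)).trans
      (M.U_add_le n c (hs.admission n c).1 hε)
  refine (Finset.sum_le_sum fun n _ => Finset.sum_le_sum fun c _ => h1 n c).trans_eq ?_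
  simp only [Finset.sum_add_distrib, Utot]
  simp [sq, mul_assoc]

end Expectation

section Main

variable {M : EHNetwork L S H} {V : ℝ} {π : PMF (S × H)} {Ω : Type w} [mΩ : MeasurableSpace Ω]
  {Pr : Measure Ω} {ℱ : Filtration ℕ mΩ} {s : ℕ → Ω → S} {h : ℕ → Ω → H} {X : Ω → SamplePath L}
  [IsProbabilityMeasure Pr]

lemma IsPolicy.Utot_avgRate_isBoundedUnder (hX : M.IsPolicy π Pr ℱ s h X) :
    IsBoundedUnder (· ≤ ·) atTop fun T => M.Utot (avgRate Pr X T) :=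
  isBoundedUnder_of ⟨M.Utot fun _ _ => M.Rmax, fun T => Finset.sum_le_sum fun n _ =>
    Finset.sum_le_sum fun c _ =>
      M.U_mono n c (hX.avgRate_mem_Icc T n c).1 (hX.avgRate_mem_Icc T n c).2⟩

lemma IsPolicy.le_liminf_Utot [Finite S] [Finite H] (hX : M.IsPolicy π Pr ℱ s h X)
    (hesa : ∀ ω, M.IsESA V (fun _ => M.θ V) (fun t => s t ω) (fun t => h t ω) (X ω))
    (hV : 0 < V) {r : Fin N → Fin N → ℝ} (hr : EHNetwork.IsAchievable.{u, v, w'} M π r) :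
    M.Utot r - M.Btilde / V ≤ liminf (fun T => M.Utot (avgRate Pr X T)) atTop := by
  cases nonempty_fintype S
  cases nonempty_fintype H
  obtain ⟨Ω', mΩ', Pr', _, ℱ', s', h', X', hX', hstable, rfl⟩ := hr
  -- the total loss for a given `ε`
  set κ : ℝ := (N : ℝ) ^ 2 * M.β + (N : ℝ) ^ 2 * (M.β * V + M.Rmax) / V with hκ
  have key : ∀ ε > 0, M.Utot (timeAvgRate Pr' X') - M.Btilde / V - κ * ε ≤
      liminf (fun T => M.Utot (avgRate Pr X T)) atTop := by
    intro ε hε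
    obtain ⟨ρ, f, p, hs⟩ := hX'.exists_isStationaryBound hstable hε
    set ℓ := (∫ ω, lyapunov (M.θ V) ((X ω).Q 0) ((X ω).E 0) ∂Pr) / V with hℓ
    have hlim : Tendsto (fun T : ℕ => M.Utot (timeAvgRate Pr' X') - M.Btilde / V - κ * ε
        - ℓ * (1 / (T : ℝ))) atTop
        (𝓝 (M.Utot (timeAvgRate Pr' X') - M.Btilde / V - κ * ε)) := by
      simpa using tendsto_const_nhds.sub (tendsto_one_div_atTop_nhds_zero_nat.const_mul ℓ)
    rw [← hlim.liminf_eq]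
    refine liminf_le_liminf ?_ hlim.isBoundedUnder_ge
      hX.Utot_avgRate_isBoundedUnder.isCoboundedUnder_ge
    filter_upwards [eventually_ne_atTop 0] with T hT
    refine le_trans ?_ (hX.Utot_avgRate_ge hesa hV hε.le hs hT)
    have h1 := hs.Utot_le hε.le
    have h2 : (M.Btilde + (N : ℝ) ^ 2 * ((M.β * V + M.Rmax) * ε)) / V =
        M.Btilde / V + (N : ℝ) ^ 2 * (M.β * V + M.Rmax) / V * ε := by
      field_simp
    rw [h2, hκ]
    linarith
  have hlim : Tendsto (fun ε : ℝ => M.Utot (timeAvgRate Pr' X') - M.Btilde / V - κ * ε)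
      (𝓝[>] 0) (𝓝 (M.Utot (timeAvgRate Pr' X') - M.Btilde / V - κ * 0)) :=
    ((continuous_const.sub (continuous_const.mul continuous_id)).tendsto 0).mono_left
      nhdsWithin_le_nhds
  rw [mul_zero, sub_zero] at hlim
  exact le_of_tendsto hlim (eventually_nhdsWithin_of_forall key)

lemma IsPolicy.tendsto_Utot (hX : M.IsPolicy π Pr ℱ s h X)
    (hlim : ∀ n c, ∃ a, Tendsto (fun T => avgRate Pr X T n c) atTop (𝓝 a)) :
    Tendsto (fun T => M.Utot (avgRate Pr X T)) atTop (𝓝 (M.Utot (timeAvgRate Pr X))) := by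
  refine tendsto_finsetSum _ fun n _ => tendsto_finsetSum _ fun c _ => ?_
  obtain ⟨a, ha⟩ := hlim n c
  have h1 : timeAvgRate Pr X n c = a := ha.liminf_eq
  rw [← h1] at ha
  exact ((M.U_contDiff n c).continuousOn _ (hX.timeAvgRate_nonneg n c)).tendsto.comp
    (tendsto_nhdsWithin_iff.2 ⟨ha, Eventually.of_forall fun T => (hX.avgRate_mem_Icc T n c).1⟩)

end Main

end EHNetwork

theorem theorem2 {N : ℕ} {L : Finset (Fin N × Fin N)} {S : Type u} {H : Type v}
    [Finite S] [Finite H] (M : EHNetwork L S H) (V : ℝ) (hV : 0 < V) :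
    -- (a) along every sample path, for arbitrary channel and energy state sequences
    (∀ (s : ℕ → S) (h : ℕ → H) (x : SamplePath L), M.IsESA V (fun _ => M.θ V) s h x →
      ∀ t,
        (∀ n c, 0 ≤ x.Q t n c ∧ x.Q t n c ≤ M.β * V + M.Rmax) ∧
        (∀ n, 0 ≤ x.E t n ∧ x.E t n ≤ M.θ V + M.hmax) ∧
        (∀ l : ↥L, x.P t l ≠ 0 → M.Pmax ≤ x.E t l.1.1) ∧
        (∀ n, outSum (x.P t) n ≤ x.E t n) ∧
        -- the energy-availability constraint is redundant in the power allocation step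
        (∀ p : ↥L → ℝ,
          (p ∈ M.powerSet (s t) ∧
            IsMaxOn (M.powerObjective (fun _ => M.θ V) (s t) (x.Q t) (x.E t))
              (M.powerSet (s t)) p) ↔
          (p ∈ M.availablePower (s t) (x.E t) ∧
            IsMaxOn (M.powerObjective (fun _ => M.θ V) (s t) (x.Q t) (x.E t))
              (M.availablePower (s t) (x.E t)) p))) ∧
    -- (b) utility, for i.i.d. states
    (∀ (π : PMF (S × H)) (Ω : Type w) (mΩ : MeasurableSpace Ω) (Pr : Measure Ω)
      (_ : IsProbabilityMeasure Pr) (ℱ : Filtration ℕ mΩ) (s : ℕ → Ω → S) (h : ℕ → Ω → H)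
      (X : Ω → SamplePath L),
      M.IsPolicy π Pr ℱ s h X →
      (∀ ω, M.IsESA V (fun _ => M.θ V) (fun t => s t ω) (fun t => h t ω) (X ω)) →
      ∀ r : Fin N → Fin N → ℝ, EHNetwork.IsAchievable.{u, v, w'} M π r →
        M.Utot r - M.Btilde / V ≤ liminf (fun T => M.Utot (avgRate Pr X T)) atTop ∧
        ((∀ n c, ∃ a, Tendsto (fun T => avgRate Pr X T n c) atTop (𝓝 a)) →
          M.Utot r - M.Btilde / V ≤ M.Utot (timeAvgRate Pr X))) := by
  constructor
  · intro s h x hx t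
    have hE := hx.feasible.E_nonneg t
    have hW := hx.linkWeight_le hV.le t
    exact ⟨fun n c => ⟨hx.feasible.Q_nonneg t n c, hx.Q_le hV.le t n c⟩,
      fun n => ⟨hE n, hx.E_le hV.le t n⟩,
      fun l => M.Pmax_le_of_isMaxOn hW (fun _ hp => hp.1) (hx.feasible.power t)
        (M.update_mem_availablePower (hx.feasible.power t)) (hx.power t) l,
      (hx.feasible.power t).2, M.isMaxOn_powerSet_iff hE hW⟩
  · intro π Ω mΩ Pr _ ℱ s h X hX hesa r hr
    have hlow := hX.le_liminf_Utot hesa hV hr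
    refine ⟨hlow, fun hlim => ?_⟩
    rwa [(hX.tendsto_Utot hlim).liminf_eq] at hlow
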